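/- Let $a(t)=e^{-1/t}$ for $t>0$, $a(t)=0$ for $t\le 0$, $b(t)=\dfrac{a(t)}{a(t)+a(1-t)}$, and for $\varepsilon>0$ let $c_\varepsilon(t)=b(-t/\varepsilon+2)$, so that $c_\varepsilon=1$ on $[0,\varepsilon]$ and $c_\varepsilon=0$ on $[2\varepsilon,\infty)$. For $\theta=\pm\frac{\pi}{2n}$ put $\rho=\tan(\theta/2)\,c_\varepsilon$ and $$g(x,X)=\frac{(x-X)^2}{2\sin\theta}-\frac12\sum_{k\in\mathbb Z}\rho\big((x-k)^2+(X-k)^2\big)\,\big((x-k)^2+(X-k)^2\big).$$ **Proposition.** For every $\varepsilon>0$ there are an integer $N\ge 3$ and a $\delta>0$ such that the following holds for every integer $n\ge N$, every $\sigma\in\{1,-1\}$ and $\theta=\sigma\frac{\pi}{2n}$. There is a (necessarily unique) map $\psi:\mathbb R^2\to\mathbb R^2$ such that $(X,Y)=\psi(x,y)$ if and only if $g_x(x,X)=-y$ and $g_X(x,X)=Y$. It is of class $C^\infty$ and has the following properties. 1. If $\varepsilon<1$, then $\psi$ is a rotation near the lattice points $(k,0)$: for all $k\in\mathbb Z$ and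 all $(x,y)$ with $(x-k)^2+y^2\le\delta^2$, $$\psi(x,y)=\big(k+(\cos\theta)(x-k)+(\sin\theta)y,\ -(\sin\theta)(x-k)+(\cos\theta)y\big).$$ 2. $\psi$ is a shear away from the lattice points: $\psi(x,y)=(x+(\sin\theta)y,\,y)$ whenever $(x-k)^2+(x+(\sin\theta)y-k)^2\ge 2\varepsilon$ for all $k\in\mathbb Z$. 3. Let $a<b$ be real numbers with $|a|,|b|\ge 2\sqrt\varepsilon/|\sin\theta|$, and let $A=\{(x,y)\in\mathbb R^2: a\le y\le b\}$. Then $\psi|_A=(f_1,f_2)$ is a smooth monotone twist mapping of sign $\sigma$: it is $C^\infty$ on $A$, and on $A$ one has $\partial(f_1,f_2)/\partial(x,y)\equiv1$, $f_1(x+1,y)=f_1(x,y)+1$, $f_2(x+1,y)=f_2(x,y)$, $f_2(x,y)=y$ for $y=a,b$, and $\sigma\,\partial f_1/\partial y>0$. 4. For the same $a,b$ there is a function $H=H(t,x,y)\in C^\infty(\mathbb R\times A)$ such that - $H(t+1,x,y)=H(t,x,y)=H(t,x+1,y)$; - $H_x(t,x,y)=0$ for $y=a,b$; - $\sigma H_{yy}>0$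 on $\mathbb R\times A$ (so $H_{yy}>0$ if $\theta>0$ and $H_{yy}<0$ if $\theta<0$); - for each initial value in $A$ at time $0$, the system $\dot x=H_y(t,x,y)$, $\dot y=-H_x(t,x,y)$ has a solution that stays in $A$ for all $t\in\mathbb R$, and every solution $(x(t),y(t))$ in $A$ on $[0,1]$ satisfies $(x(1),y(1))=\psi(x(0),y(0))$. (Derivatives in $y$ on the lines $y=a,b$ are one-sided.) -/

import Mathlib

open Set
open scoped ContDiff

noncomputable section

namespace BraidTwist

/-- The cutoff `c_ε(t) = b(-t/ε + 2)` with `b(t) = a(t) / (a(t) + a(1-t))`, `a(t) = exp(-1/t)` for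
`t > 0` and `a(t) = 0` for `t ≤ 0`; Mathlib's `Real.smoothTransition` is this function `b`. -/
def cutoff (ε t : ℝ) : ℝ := Real.smoothTransition (-t / ε + 2)

/-- The radial profile `ρ = ξ c_ε` with `ξ = tan (θ/2)`. -/
def profile (ε θ t : ℝ) : ℝ := Real.tan (θ / 2) * cutoff ε t

/-- Squared distance of `(x, X)` from the diagonal lattice point `(k, k)`. -/
def sqDist (k : ℤ) (x X : ℝ) : ℝ := (x - k) ^ 2 + (X - k) ^ 2

/-- The generating function `g(x, X)`. For `ε > 0` only finitely many summands are nonzero at each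
point, so the sum over `ℤ` is a finite sum. -/
def genFun (ε θ x X : ℝ) : ℝ :=
  (x - X) ^ 2 / (2 * Real.sin θ)
    - 1 / 2 * ∑ᶠ k : ℤ, profile ε θ (sqDist k x X) * sqDist k x X

/-- `ψ : (x, y) ↦ (X, Y)` is the map generated by `g`: the equation `(X, Y) = ψ (x, y)` is
equivalent to `g_x(x, X) = -y`, `g_X(x, X) = Y`. There is at most one such map. -/
def IsGeneratedBy (g : ℝ → ℝ → ℝ) (ψ : ℝ × ℝ → ℝ × ℝ) : Prop :=
  ∀ x y X Y : ℝ, ψ (x, y) = (X, Y) ↔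
    (deriv (fun s => g s X) x = -y ∧ deriv (fun S => g x S) X = Y)

/-- The strip `A = {(x, y) | a ≤ y ≤ b}`, the universal cover of an annulus. -/
def strip (a b : ℝ) : Set (ℝ × ℝ) := {p | p.2 ∈ Icc a b}

/-- Partial derivative in the first variable of a function on the strip. -/
def partialX (F : ℝ → ℝ → ℝ) (x y : ℝ) : ℝ := deriv (fun s => F s y) x

/-- Partial derivative in the second variable of a function on the strip `a ≤ y ≤ b`
(one-sided at the two boundary lines). -/
def partialY (a b : ℝ) (F : ℝ → ℝ → ℝ) (x y : ℝ) : ℝ := derivWithin (fun s => F x s) (Icc a b) y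

/-- `φ = (f, g)` is a smooth monotone twist mapping on the strip `a ≤ y ≤ b`. For `σ = 1` the twist
condition is `∂f/∂y > 0`; for `σ = -1` it is `∂f/∂y < 0`. -/
structure IsMonotoneTwist (σ a b : ℝ) (φ : ℝ × ℝ → ℝ × ℝ) : Prop where
  smooth : ContDiffOn ℝ ∞ φ (strip a b)
  jacobian : ∀ x, ∀ y ∈ Icc a b,
    partialX (fun x y => (φ (x, y)).1) x y * partialY a b (fun x y => (φ (x, y)).2) x y
      - partialY a b (fun x y => (φ (x, y)).1) x y * partialX (fun x y => (φ (x, y)).2) x y = 1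
  periodic_fst : ∀ x, ∀ y ∈ Icc a b, (φ (x + 1, y)).1 = (φ (x, y)).1 + 1
  periodic_snd : ∀ x, ∀ y ∈ Icc a b, (φ (x + 1, y)).2 = (φ (x, y)).2
  boundary_left : ∀ x, (φ (x, a)).2 = a
  boundary_right : ∀ x, (φ (x, b)).2 = b
  twist : ∀ x, ∀ y ∈ Icc a b, 0 < σ * partialY a b (fun x y => (φ (x, y)).1) x y

/-- `γ = (x, y)` is a solution in the strip, on the time interval `I`, of
`x' = H_y(t, x, y)`, `y' = -H_x(t, x, y)`. -/
def IsSolutionOn (a b : ℝ) (H : ℝ → ℝ → ℝ → ℝ) (I : Set ℝ) (γ : ℝ → ℝ × ℝ) : Prop :=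
  ∀ t ∈ I, γ t ∈ strip a b ∧
    HasDerivWithinAt γ
      (partialY a b (H t) (γ t).1 (γ t).2, -partialX (H t) (γ t).1 (γ t).2) I t

/-- `H(t, x, y)` is a smooth Hamiltonian on `ℝ × A`, 1-periodic in `t` and `x`, with `H_x = 0` on
the boundary lines and `σ H_yy > 0`, whose solutions exist in `A` for all times and whose flow
at time one is `φ`. -/
structure IsHamiltonianFor (σ a b : ℝ) (φ : ℝ × ℝ → ℝ × ℝ) (H : ℝ → ℝ → ℝ → ℝ) : Prop where
  smooth : ContDiffOn ℝ ∞ (fun q : ℝ × ℝ × ℝ => H q.1 q.2.1 q.2.2) {q | q.2 ∈ strip a b}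
  periodic_time : ∀ t x, ∀ y ∈ Icc a b, H (t + 1) x y = H t x y
  periodic_space : ∀ t x, ∀ y ∈ Icc a b, H t (x + 1) y = H t x y
  boundary_left : ∀ t x, partialX (H t) x a = 0
  boundary_right : ∀ t x, partialX (H t) x b = 0
  convex : ∀ t x, ∀ y ∈ Icc a b, 0 < σ * partialY a b (partialY a b (H t)) x y
  flow_exists : ∀ p ∈ strip a b, ∃ γ : ℝ → ℝ × ℝ, γ 0 = p ∧ IsSolutionOn a b H univ γ
  flow_time_one : ∀ γ : ℝ → ℝ × ℝ, IsSolutionOn a b H (Icc 0 1) γ → γ 1 = φ (γ 0)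

end BraidTwist

end

/-!
Put `s = sin θ`, `v = s y` and `F = ½ ∑ₖ c_ε(rₖ) rₖ`. Since `s tan (θ/2) = 1 - cos θ`, the equations
`g_x = -y`, `g_X = Y` become

  `X + l F_x(x, X) = x + v`,  `V = X - x - l F_X(x, X)`,  with `l = 1 - cos θ`,

so `ψ` is the map `Ψ_l` generated by `(X - x)² / 2 - l F(x, X)`, in rescaled momentum. The number
`n` enters through `l` and `s` only, and `l` is small for large `n`. The function `F` is smooth,
nonnegative, periodic along the diagonal and supported in `|X - x| ≤ 2 √ε`, so its derivatives are
bounded. For small `l` the first equation therefore has a unique solution `X`, smooth by the implicit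
function theorem (`contDiff_of_forall_eq_zero_iff`), and differentiating the equations gives the
Jacobian and the twist condition. Where `F = 0` its gradient vanishes too, because `F ≥ 0`, and `Ψ_l`
is a shear; near a lattice point `F = rₖ / 2` and `ψ` is a rotation. The same remarks for the inverse
map show that `Ψ_l` preserves every strip bounded by lines `|v| ≥ 2 √ε` (`newMom_eq_or`).

For the Hamiltonian, let `S_t (x, v) = (x + t v, v)` and let `c` be a smooth path from `0` to `l`,
constant near both ends of `[0, 1]`. The isotopy `S_{t-1} ∘ Ψ_{c(t)}` is the free motion `S_t` for
small `t` and ends at `Ψ_l`. By the Hamilton–Jacobi equation for the family `Ψ_l` its Hamiltonian is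

  `H(t, q, p) = p² / 2 + c'(t) F(ξ, q + (1 - t) p)`,

with `ξ` the position which `Ψ_{c(t)}` maps to `q + (1 - t) p` with new momentum `p`
(`hasDerivAt_isotopy`). It equals `p² / 2` for `t` near `0` and `1`, hence extends periodically to a
smooth function of time. The second derivative in `p` of the perturbation is `c'` times a bounded
function, by compactness modulo periods, so `H_pp > 0` when `l`, and with it `c'`, is small
(`exists_coeffPath`). The trajectories are explicit, which shows that they are complete and stay in
the strip; they are the only ones because the vector field is locally Lipschitz (`solution_unique`).
-/

open Filter Topology

namespace BraidTwist

/-! ### Smooth functions of two variables -/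

/-- The partial derivative in the second variable of a function of two variables. -/
noncomputable def partialSnd (G : ℝ → ℝ → ℝ) (x y : ℝ) : ℝ := deriv (G x) y

/-- Differentiation in a real variable preserves joint smoothness in that variable and a
parameter. -/
theorem contDiff_deriv_param {E : Type*} [NormedAddCommGroup E] [NormedSpace ℝ E]
    {G : E → ℝ → ℝ} (hG : ContDiff ℝ ∞ (Function.uncurry G)) :
    ContDiff ℝ ∞ (Function.uncurry fun e u => deriv (G e) u) := by
  have h : ContDiff ℝ ∞ (fun z : E × ℝ => fderiv ℝ (G z.1) z.2) := by
    refine ContDiff.fderiv (f := fun z : E × ℝ => G z.1) (m := ∞) ?_ contDiff_snd (by simp)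
    exact hG.comp (by fun_prop : ContDiff ℝ ∞ (fun z : (E × ℝ) × ℝ => (z.1.1, z.2)))
  exact h.clm_apply (contDiff_const (c := (1 : ℝ)))

theorem contDiff_comp₂ {E : Type*} [NormedAddCommGroup E] [NormedSpace ℝ E]
    {G : ℝ → ℝ → ℝ} (hG : ContDiff ℝ ∞ (Function.uncurry G)) {a b : E → ℝ}
    (ha : ContDiff ℝ ∞ a) (hb : ContDiff ℝ ∞ b) : ContDiff ℝ ∞ (fun e => G (a e) (b e)) :=
  hG.comp (ha.prodMk hb)

theorem contDiff_partialSnd {G : ℝ → ℝ → ℝ} (hG : ContDiff ℝ ∞ (Function.uncurry G)) :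
    ContDiff ℝ ∞ (Function.uncurry (partialSnd G)) :=
  contDiff_deriv_param hG

theorem contDiff_swap {G : ℝ → ℝ → ℝ} (hG : ContDiff ℝ ∞ (Function.uncurry G)) :
    ContDiff ℝ ∞ (Function.uncurry fun x y => G y x) :=
  contDiff_comp₂ hG contDiff_snd contDiff_fst

theorem contDiff_partialX {G : ℝ → ℝ → ℝ} (hG : ContDiff ℝ ∞ (Function.uncurry G)) :
    ContDiff ℝ ∞ (Function.uncurry (partialX G)) :=
  contDiff_swap (contDiff_deriv_param (contDiff_swap hG))

theorem partialX_eq_fderiv {G : ℝ → ℝ → ℝ} (hG : ContDiff ℝ ∞ (Function.uncurry G)) (x y : ℝ) :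
    partialX G x y = fderiv ℝ (Function.uncurry G) (x, y) (1, 0) := by
  have h := (hG.differentiable (by simp) (x, y)).hasFDerivAt
  have h2 : HasDerivAt (fun s : ℝ => (s, y)) ((1, 0) : ℝ × ℝ) x :=
    (hasDerivAt_id x).prodMk (hasDerivAt_const x y)
  exact (h.comp_hasDerivAt x h2).deriv

theorem partialSnd_eq_fderiv {G : ℝ → ℝ → ℝ} (hG : ContDiff ℝ ∞ (Function.uncurry G)) (x y : ℝ) :
    partialSnd G x y = fderiv ℝ (Function.uncurry G) (x, y) (0, 1) := by
  have h := (hG.differentiable (by simp) (x, y)).hasFDerivAt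
  have h2 : HasDerivAt (fun s : ℝ => (x, s)) ((0, 1) : ℝ × ℝ) y :=
    (hasDerivAt_const y x).prodMk (hasDerivAt_id y)
  exact (h.comp_hasDerivAt y h2).deriv

/-- The chain rule for a function of two variables along a curve. -/
theorem hasDerivAt_comp₂ {G : ℝ → ℝ → ℝ} (hG : ContDiff ℝ ∞ (Function.uncurry G))
    {a b : ℝ → ℝ} {a' b' t : ℝ} (ha : HasDerivAt a a' t) (hb : HasDerivAt b b' t) :
    HasDerivAt (fun s => G (a s) (b s))
      (partialX G (a t) (b t) * a' + partialSnd G (a t) (b t) * b') t := by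
  have h := (hG.differentiable (by simp) (a t, b t)).hasFDerivAt
  have h3 := h.comp_hasDerivAt t (ha.prodMk hb)
  have h4 : ((a', b') : ℝ × ℝ) = a' • ((1, 0) : ℝ × ℝ) + b' • ((0, 1) : ℝ × ℝ) := by simp
  rw [h4, map_add, map_smul, map_smul, ← partialX_eq_fderiv hG, ← partialSnd_eq_fderiv hG] at h3
  exact h3.congr_deriv (by simp [mul_comm])

theorem partialX_partialSnd {G : ℝ → ℝ → ℝ} (hG : ContDiff ℝ ∞ (Function.uncurry G)) (x y : ℝ) :
    partialX (partialSnd G) x y = partialSnd (partialX G) x y := by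
  have hs : IsSymmSndFDerivAt ℝ (Function.uncurry G) (x, y) :=
    hG.contDiffAt.isSymmSndFDerivAt (by
      simpa using WithTop.coe_le_coe.2 (le_top : (2 : ℕ∞) ≤ ⊤))
  have hd : DifferentiableAt ℝ (fderiv ℝ (Function.uncurry G)) (x, y) :=
    (hG.fderiv_right (m := ∞) (by simp)).differentiable (by simp) _
  have e1 : Function.uncurry (partialX G) =
      fun p => fderiv ℝ (Function.uncurry G) p (1, 0) :=
    funext fun p => partialX_eq_fderiv hG p.1 p.2
  have e2 : Function.uncurry (partialSnd G) =
      fun p => fderiv ℝ (Function.uncurry G) p (0, 1) :=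
    funext fun p => partialSnd_eq_fderiv hG p.1 p.2
  rw [partialX_eq_fderiv (contDiff_partialSnd hG), partialSnd_eq_fderiv (contDiff_partialX hG),
    e1, e2, fderiv_clm_apply hd (by fun_prop), fderiv_clm_apply hd (by fun_prop)]
  simpa using hs.eq (1, 0) (0, 1)

/-! ### A global implicit function theorem -/

theorem half_sub_le_of_half_le_deriv {f : ℝ → ℝ} (hf : Differentiable ℝ f)
    (h : ∀ u, 1 / 2 ≤ deriv f u) {u w : ℝ} (huw : u ≤ w) : (w - u) / 2 ≤ f w - f u := by
  have := mul_sub_le_image_sub_of_le_deriv hf h huw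
  linarith

/-- A function with derivative at least `1/2` has exactly one zero. -/
theorem existsUnique_zero {f : ℝ → ℝ} (hf : Differentiable ℝ f)
    (h : ∀ u, 1 / 2 ≤ deriv f u) : ∃! u, f u = 0 := by
  have hs : StrictMono f := strictMono_of_deriv_pos fun u => by linarith [h u]
  have hex : ∃ u, f u = 0 := by
    have h1 := half_sub_le_of_half_le_deriv hf h (u := 0) (w := 2 * |f 0|) (by positivity)
    have h2 := half_sub_le_of_half_le_deriv hf h (u := -(2 * |f 0|)) (w := 0) (by simp)
    have := intermediate_value_Icc (show -(2 * |f 0|) ≤ 2 * |f 0| by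
      linarith [abs_nonneg (f 0)]) hf.continuous.continuousOn
    obtain ⟨u, -, hu⟩ := this (show (0 : ℝ) ∈ Icc _ _ from
      ⟨by linarith [le_abs_self (f 0)], by linarith [neg_abs_le (f 0)]⟩)
    exact ⟨u, hu⟩
  obtain ⟨u, hu⟩ := hex
  exact ⟨u, hu, fun w hw => hs.injective (hw.trans hu.symm)⟩

/-- If `∂f/∂u ≥ 1/2` everywhere, the solution `u = s(e)` of `f(e, u) = 0` is a smooth function
of `e`: locally it is the function given by the implicit function theorem. -/
theorem contDiff_of_forall_eq_zero_iff {E : Type*} [NormedAddCommGroup E] [NormedSpace ℝ E]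
    [CompleteSpace E] {f : E → ℝ → ℝ} (hf : ContDiff ℝ ∞ (Function.uncurry f))
    (h : ∀ e u, 1 / 2 ≤ deriv (f e) u) {s : E → ℝ} (hs : ∀ e u, f e u = 0 ↔ u = s e) :
    ContDiff ℝ ∞ s := by
  rw [contDiff_iff_contDiffAt]
  intro e
  have hc : ContDiffAt ℝ ∞ (Function.uncurry f) (e, s e) := hf.contDiffAt
  have hd : ((fderiv ℝ (Function.uncurry f) (e, s e)) ∘L .inr ℝ E ℝ) 1 = deriv (f e) (s e) := by
    have h1 := (hf.differentiable (by simp) (e, s e)).hasFDerivAt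
    have h2 : HasDerivAt (fun u : ℝ => (e, u)) ((0, 1) : E × ℝ) (s e) :=
      (hasDerivAt_const _ _).prodMk (hasDerivAt_id _)
    exact ((h1.comp_hasDerivAt _ h2).deriv).symm
  have hinv : ((fderiv ℝ (Function.uncurry f) (e, s e)) ∘L .inr ℝ E ℝ).IsInvertible := by
    have hne : deriv (f e) (s e) ≠ 0 := by linarith [h e (s e)]
    refine ⟨ContinuousLinearEquiv.unitsEquivAut ℝ (Units.mk0 _ hne), ?_⟩
    ext
    simpa using hd.symm
  refine (hc.contDiffAt_implicitFunction (by simp) hinv).congr_of_eventuallyEq ?_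
  filter_upwards [hc.eventually_apply_implicitFunction (by simp) hinv] with x hx
  refine ((hs _ _).1 ?_).symm
  exact hx.trans ((hs e (s e)).2 rfl)

end BraidTwist

namespace BraidTwist

/-! ### The maps generated by `(X - x)² / 2 - l F(x, X)` -/

/-- A smooth nonnegative function of `(x, X)`, periodic along the diagonal and supported in the
band `|X - x| ≤ R`: the perturbation term of a generating function. -/
structure IsDiagonalBump (F : ℝ → ℝ → ℝ) (R : ℝ) : Prop where
  smooth : ContDiff ℝ ∞ (Function.uncurry F)
  nonneg : ∀ x X, 0 ≤ F x X
  periodic : ∀ x X, F (x + 1) (X + 1) = F x X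
  eq_zero : ∀ x X, R ≤ |X - x| → F x X = 0

/-- The coefficient `l` is so small that `(X - x)² / 2 - l F(x, X)` satisfies the twist
condition, with mixed derivative at most `-1/2`. -/
def IsSmallCoeff (F : ℝ → ℝ → ℝ) (l : ℝ) : Prop :=
  ∀ x X, |l * partialSnd (partialX F) x X| ≤ 1 / 2

/-- The solution `X` of `X + l F_x(x, X) = x + v`: the new position under the map generated by
`(X - x)² / 2 - l F(x, X)`. It is meaningful for small `l` only. -/
noncomputable def newPos (F : ℝ → ℝ → ℝ) (l x v : ℝ) : ℝ :=
  Classical.epsilon fun X => X + l * partialX F x X = x + v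

/-- The solution `x` of `x + l F_X(x, X) = X - V`: the old position under the map generated by
`(X - x)² / 2 - l F(x, X)`. It is meaningful for small `l` only. -/
noncomputable def oldPos (F : ℝ → ℝ → ℝ) (l X V : ℝ) : ℝ :=
  Classical.epsilon fun x => x + l * partialSnd F x X = X - V

/-- The momentum `V = X - x - l F_X(x, X)` belonging to the new position `X = newPos F l x v`. -/
noncomputable def newMom (F : ℝ → ℝ → ℝ) (l x v : ℝ) : ℝ :=
  newPos F l x v - x - l * partialSnd F x (newPos F l x v)

variable {F : ℝ → ℝ → ℝ} {R l : ℝ}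

theorem IsSmallCoeff.pos (hl : IsSmallCoeff F l) (x X : ℝ) :
    0 < 1 + l * partialSnd (partialX F) x X := by
  linarith [(abs_le.1 (hl x X)).1]

theorem hasDerivAt_snd (hG : ContDiff ℝ ∞ (Function.uncurry F)) (x X : ℝ) :
    HasDerivAt (fun s => F x s) (partialSnd F x X) X := by
  simpa using hasDerivAt_comp₂ hG (hasDerivAt_const X x) (hasDerivAt_id X)

theorem hasDerivAt_fst (hG : ContDiff ℝ ∞ (Function.uncurry F)) (x X : ℝ) :
    HasDerivAt (fun s => F s X) (partialX F x X) x := by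
  simpa using hasDerivAt_comp₂ hG (hasDerivAt_id x) (hasDerivAt_const x X)

namespace IsDiagonalBump

theorem partialX_of_eq_zero (hF : IsDiagonalBump F R) {x X : ℝ} (h : F x X = 0) :
    partialX F x X = 0 :=
  IsLocalMin.deriv_eq_zero <| Eventually.of_forall fun s => by
    simpa [h] using hF.nonneg s X

theorem partialSnd_of_eq_zero (hF : IsDiagonalBump F R) {x X : ℝ} (h : F x X = 0) :
    partialSnd F x X = 0 :=
  IsLocalMin.deriv_eq_zero <| Eventually.of_forall fun s => by
    simpa [h] using hF.nonneg x s

theorem partialX_periodic (hF : IsDiagonalBump F R) (x X : ℝ) :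
    partialX F (x + 1) (X + 1) = partialX F x X := by
  have : (fun s => F s X) = fun s => F (s + 1) (X + 1) := funext fun s => (hF.periodic s X).symm
  rw [partialX, partialX, this]
  exact (deriv_comp_add_const (fun s => F s (X + 1)) 1 x).symm

theorem partialSnd_periodic (hF : IsDiagonalBump F R) (x X : ℝ) :
    partialSnd F (x + 1) (X + 1) = partialSnd F x X := by
  have : F x = fun s => F (x + 1) (s + 1) := funext fun s => (hF.periodic x s).symm
  rw [partialSnd, partialSnd, this]
  exact (deriv_comp_add_const (F (x + 1)) 1 X).symm

theorem partialSnd_partialX_periodic (hF : IsDiagonalBump F R) (x X : ℝ) :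
    partialSnd (partialX F) (x + 1) (X + 1) = partialSnd (partialX F) x X := by
  have : partialX F x = fun s => partialX F (x + 1) (s + 1) :=
    funext fun s => (hF.partialX_periodic x s).symm
  rw [partialSnd, partialSnd, this]
  exact (deriv_comp_add_const (partialX F (x + 1)) 1 X).symm

theorem partialSnd_partialX_eq_zero (hF : IsDiagonalBump F R) {x X : ℝ} (h : R < |X - x|) :
    partialSnd (partialX F) x X = 0 := by
  have : partialX F x =ᶠ[𝓝 X] fun _ => 0 := by
    have hc : ContinuousAt (fun s : ℝ => |s - x|) X := by fun_prop
    filter_upwards [hc.eventually (lt_mem_nhds h)] with s hs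
    exact hF.partialX_of_eq_zero (hF.eq_zero x s hs.le)
  rw [partialSnd, this.deriv_eq, deriv_const]

/-- The second derivatives of `F` are bounded, as `F` is periodic with compact support modulo
periods; hence all small coefficients are admissible. -/
theorem exists_isSmallCoeff (hF : IsDiagonalBump F R) :
    ∃ l₀ : ℝ, 0 < l₀ ∧ ∀ l, |l| ≤ l₀ → IsSmallCoeff F l := by
  have hc : Continuous (fun z : ℝ × ℝ => partialSnd (partialX F) z.1 (z.1 + z.2)) :=
    (contDiff_comp₂ (contDiff_partialSnd (contDiff_partialX hF.smooth)) contDiff_fst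
      (contDiff_fst.add contDiff_snd)).continuous
  obtain ⟨C, hC⟩ := (isCompact_Icc.prod isCompact_Icc :
    IsCompact (Icc (0 : ℝ) 1 ×ˢ Icc (-R) R)).exists_bound_of_continuousOn hc.continuousOn
  have key : ∀ x X, |partialSnd (partialX F) x X| ≤ max C 0 := by
    intro x X
    have hper : ∀ d, Function.Periodic (fun s => partialSnd (partialX F) s (s + d)) 1 := by
      intro d s
      simp only [show s + 1 + d = s + d + 1 by ring]
      exact hF.partialSnd_partialX_periodic s (s + d)
    rcases lt_or_ge R |X - x| with h | h
    · simp [hF.partialSnd_partialX_eq_zero h]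
    · obtain ⟨y, hy, hxy⟩ := (hper (X - x)).exists_mem_Ico₀ one_pos x
      simp only [add_sub_cancel] at hxy
      rw [hxy]
      exact le_max_of_le_left (hC (y, X - x) ⟨⟨hy.1, hy.2.le⟩, abs_le.1 h⟩)
  have hM : 0 ≤ max C 0 := le_max_right _ _
  refine ⟨1 / (2 * (max C 0 + 1)), by positivity, fun l hl x X => ?_⟩
  rw [abs_mul]
  calc |l| * |partialSnd (partialX F) x X| ≤ 1 / (2 * (max C 0 + 1)) * max C 0 := by
        gcongr
        exact key x X
    _ ≤ 1 / 2 := by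
        rw [div_mul_eq_mul_div, div_le_div_iff₀ (by positivity) (by positivity)]
        linarith

theorem hasDerivAt_newPos_eq (hF : IsDiagonalBump F R) (l x v X : ℝ) :
    HasDerivAt (fun u => u + l * partialX F x u - x - v)
      (1 + l * partialSnd (partialX F) x X) X := by
  have h := hasDerivAt_snd (contDiff_partialX hF.smooth) x X
  exact (((hasDerivAt_id X).add (h.const_mul l)).sub_const x).sub_const v

theorem hasDerivAt_oldPos_eq (hF : IsDiagonalBump F R) (l x X V : ℝ) :
    HasDerivAt (fun u => u + l * partialSnd F u X - X + V)
      (1 + l * partialSnd (partialX F) x X) x := by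
  have h := hasDerivAt_fst (contDiff_partialSnd hF.smooth) x X
  rw [partialX_partialSnd hF.smooth] at h
  exact (((hasDerivAt_id x).add (h.const_mul l)).sub_const X).add_const V

theorem newPos_eq_iff (hF : IsDiagonalBump F R) (hl : IsSmallCoeff F l) {x v X : ℝ} :
    X + l * partialX F x X = x + v ↔ X = newPos F l x v := by
  obtain ⟨Y, hY, hu⟩ := existsUnique_zero
    (fun u => (hF.hasDerivAt_newPos_eq l x v u).differentiableAt)
    (fun u => by
      rw [(hF.hasDerivAt_newPos_eq l x v u).deriv]
      linarith [(abs_le.1 (hl x u)).1])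
  have hs : newPos F l x v + l * partialX F x (newPos F l x v) = x + v :=
    Classical.epsilon_spec (p := fun X => X + l * partialX F x X = x + v)
      ⟨Y, by linarith⟩
  constructor
  · intro h
    rw [hu X (by linarith), hu (newPos F l x v) (by linarith)]
  · rintro rfl
    exact hs

theorem oldPos_eq_iff (hF : IsDiagonalBump F R) (hl : IsSmallCoeff F l) {x X V : ℝ} :
    x + l * partialSnd F x X = X - V ↔ x = oldPos F l X V := by
  obtain ⟨Y, hY, hu⟩ := existsUnique_zero
    (fun u => (hF.hasDerivAt_oldPos_eq l u X V).differentiableAt)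
    (fun u => by
      rw [(hF.hasDerivAt_oldPos_eq l u X V).deriv]
      linarith [(abs_le.1 (hl u X)).1])
  have hs : oldPos F l X V + l * partialSnd F (oldPos F l X V) X = X - V :=
    Classical.epsilon_spec (p := fun x => x + l * partialSnd F x X = X - V)
      ⟨Y, by linarith⟩
  constructor
  · intro h
    rw [hu x (by linarith), hu (oldPos F l X V) (by linarith)]
  · rintro rfl
    exact hs

theorem newPos_spec (hF : IsDiagonalBump F R) (hl : IsSmallCoeff F l) (x v : ℝ) :
    newPos F l x v + l * partialX F x (newPos F l x v) = x + v :=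
  (hF.newPos_eq_iff hl).2 rfl

theorem oldPos_spec (hF : IsDiagonalBump F R) (hl : IsSmallCoeff F l) (X V : ℝ) :
    oldPos F l X V + l * partialSnd F (oldPos F l X V) X = X - V :=
  (hF.oldPos_eq_iff hl).2 rfl

theorem oldPos_newPos (hF : IsDiagonalBump F R) (hl : IsSmallCoeff F l) (x v : ℝ) :
    oldPos F l (newPos F l x v) (newMom F l x v) = x :=
  ((hF.oldPos_eq_iff hl).1 (by rw [newMom]; ring)).symm

theorem contDiff_newPos (hF : IsDiagonalBump F R) {c : ℝ → ℝ} (hc : ContDiff ℝ ∞ c)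
    (hs : ∀ t, IsSmallCoeff F (c t)) :
    ContDiff ℝ ∞ (fun z : ℝ × ℝ × ℝ => newPos F (c z.1) z.2.1 z.2.2) := by
  refine contDiff_of_forall_eq_zero_iff
    (f := fun z u => u + c z.1 * partialX F z.2.1 u - z.2.1 - z.2.2) ?_ ?_ ?_
  · have h : ContDiff ℝ ∞ (fun z : (ℝ × ℝ × ℝ) × ℝ => partialX F z.1.2.1 z.2) :=
      contDiff_comp₂ (contDiff_partialX hF.smooth) (by fun_prop) (by fun_prop)
    simp only [Function.uncurry_def]
    fun_prop
  · intro e u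
    rw [(hF.hasDerivAt_newPos_eq _ _ _ u).deriv]
    linarith [(abs_le.1 (hs e.1 e.2.1 u)).1]
  · intro e u
    rw [← hF.newPos_eq_iff (hs e.1), sub_sub, sub_eq_zero]

theorem contDiff_oldPos (hF : IsDiagonalBump F R) {c : ℝ → ℝ} (hc : ContDiff ℝ ∞ c)
    (hs : ∀ t, IsSmallCoeff F (c t)) :
    ContDiff ℝ ∞ (fun z : ℝ × ℝ × ℝ => oldPos F (c z.1) z.2.1 z.2.2) := by
  refine contDiff_of_forall_eq_zero_iff
    (f := fun z u => u + c z.1 * partialSnd F u z.2.1 - z.2.1 + z.2.2) ?_ ?_ ?_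
  · have h : ContDiff ℝ ∞ (fun z : (ℝ × ℝ × ℝ) × ℝ => partialSnd F z.2 z.1.2.1) :=
      contDiff_comp₂ (contDiff_partialSnd hF.smooth) (by fun_prop) (by fun_prop)
    simp only [Function.uncurry_def]
    fun_prop
  · intro e u
    rw [(hF.hasDerivAt_oldPos_eq _ u _ _).deriv]
    linarith [(abs_le.1 (hs e.1 u e.2.1)).1]
  · intro e u
    rw [← hF.oldPos_eq_iff (hs e.1), sub_add, sub_eq_zero]

theorem contDiff_newMom (hF : IsDiagonalBump F R) {c : ℝ → ℝ} (hc : ContDiff ℝ ∞ c)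
    (hs : ∀ t, IsSmallCoeff F (c t)) :
    ContDiff ℝ ∞ (fun z : ℝ × ℝ × ℝ => newMom F (c z.1) z.2.1 z.2.2) := by
  have h1 := hF.contDiff_newPos hc hs
  have h2 : ContDiff ℝ ∞ (fun z : ℝ × ℝ × ℝ =>
      partialSnd F z.2.1 (newPos F (c z.1) z.2.1 z.2.2)) :=
    contDiff_comp₂ (contDiff_partialSnd hF.smooth) (by fun_prop) h1
  unfold newMom
  fun_prop

/-! ### Shears, periodicity, invariance of strips -/

theorem newPos_of_eq_zero (hF : IsDiagonalBump F R) (hl : IsSmallCoeff F l) {x v : ℝ}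
    (h : F x (x + v) = 0) : newPos F l x v = x + v :=
  ((hF.newPos_eq_iff hl).1 (by rw [hF.partialX_of_eq_zero h]; ring)).symm

theorem newMom_of_eq_zero (hF : IsDiagonalBump F R) (hl : IsSmallCoeff F l) {x v : ℝ}
    (h : F x (x + v) = 0) : newMom F l x v = v := by
  rw [newMom, hF.newPos_of_eq_zero hl h, hF.partialSnd_of_eq_zero h]
  ring

theorem oldPos_of_eq_zero (hF : IsDiagonalBump F R) (hl : IsSmallCoeff F l) {X V : ℝ}
    (h : F (X - V) X = 0) : oldPos F l X V = X - V :=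
  ((hF.oldPos_eq_iff hl).1 (by rw [hF.partialSnd_of_eq_zero h]; ring)).symm

theorem eq_zero_add (hF : IsDiagonalBump F R) {v : ℝ} (x : ℝ) (h : R ≤ |v|) :
    F x (x + v) = 0 :=
  hF.eq_zero _ _ (by simpa using h)

theorem eq_zero_sub (hF : IsDiagonalBump F R) {V : ℝ} (X : ℝ) (h : R ≤ |V|) :
    F (X - V) X = 0 :=
  hF.eq_zero _ _ (by simpa using h)

theorem newPos_add_one (hF : IsDiagonalBump F R) (hl : IsSmallCoeff F l) (x v : ℝ) :
    newPos F l (x + 1) v = newPos F l x v + 1 :=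
  ((hF.newPos_eq_iff hl).1 (by
    rw [hF.partialX_periodic]
    linarith [hF.newPos_spec hl x v])).symm

theorem newMom_add_one (hF : IsDiagonalBump F R) (hl : IsSmallCoeff F l) (x v : ℝ) :
    newMom F l (x + 1) v = newMom F l x v := by
  rw [newMom, newMom, hF.newPos_add_one hl, hF.partialSnd_periodic]
  ring

theorem oldPos_add_one (hF : IsDiagonalBump F R) (hl : IsSmallCoeff F l) (X V : ℝ) :
    oldPos F l (X + 1) V = oldPos F l X V + 1 :=
  ((hF.oldPos_eq_iff hl).1 (by
    rw [hF.partialSnd_periodic]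
    linarith [hF.oldPos_spec hl X V])).symm

/-- The momentum changes only where both the old and the new value lie in `(-R, R)`. -/
theorem newMom_eq_or (hF : IsDiagonalBump F R) (hl : IsSmallCoeff F l) (x v : ℝ) :
    newMom F l x v = v ∨ |v| < R ∧ |newMom F l x v| < R := by
  rcases le_or_gt R |v| with h | h
  · exact .inl (hF.newMom_of_eq_zero hl (hF.eq_zero_add x h))
  rcases le_or_gt R |newMom F l x v| with h' | h'
  · left
    have h0 := hF.eq_zero_sub (newPos F l x v) h'
    have h1 := hF.oldPos_of_eq_zero hl h0
    rw [hF.oldPos_newPos hl] at h1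
    rw [← h1] at h0
    have h2 := hF.newPos_spec hl x v
    rw [hF.partialX_of_eq_zero h0] at h2
    linarith
  · exact .inr ⟨h, h'⟩

/-- The map generated by `(X - x)² / 2 - l F(x, X)`, as a bijection of the plane. -/
noncomputable def twistEquiv (hF : IsDiagonalBump F R) (hl : IsSmallCoeff F l) :
    Equiv.Perm (ℝ × ℝ) where
  toFun p := (newPos F l p.1 p.2, newMom F l p.1 p.2)
  invFun q := (oldPos F l q.1 q.2,
    q.1 - oldPos F l q.1 q.2 + l * partialX F (oldPos F l q.1 q.2) q.1)
  left_inv p := by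
    have h := hF.newPos_spec hl p.1 p.2
    ext
    · exact hF.oldPos_newPos hl p.1 p.2
    · simp only [hF.oldPos_newPos hl]
      linarith
  right_inv q := by
    have h := hF.oldPos_spec hl q.1 q.2
    have h1 : newPos F l (oldPos F l q.1 q.2)
        (q.1 - oldPos F l q.1 q.2 + l * partialX F (oldPos F l q.1 q.2) q.1) = q.1 :=
      ((hF.newPos_eq_iff hl).1 (by ring)).symm
    ext
    · exact h1
    · simp only [newMom, h1]
      linarith

theorem twistEquiv_apply (hF : IsDiagonalBump F R) (hl : IsSmallCoeff F l) (p : ℝ × ℝ) :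
    hF.twistEquiv hl p = (newPos F l p.1 p.2, newMom F l p.1 p.2) := rfl

end IsDiagonalBump

end BraidTwist

namespace BraidTwist

namespace IsDiagonalBump

variable {F : ℝ → ℝ → ℝ} {R l : ℝ}

/-! ### First derivatives of the generated maps -/

/-- Differentiation of the equation defining the new position along a curve in `(l, x, v)`. -/
theorem hasDerivAt_newPos (hF : IsDiagonalBump F R) {c : ℝ → ℝ} (hc : ContDiff ℝ ∞ c)
    (hs : ∀ t, IsSmallCoeff F (c t)) {a b : ℝ → ℝ} {a' b' t : ℝ}
    (ha : HasDerivAt a a' t) (hb : HasDerivAt b b' t) :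
    HasDerivAt (fun s => newPos F (c s) (a s) (b s))
      ((a' + b' - deriv c t * partialX F (a t) (newPos F (c t) (a t) (b t))
          - c t * partialX (partialX F) (a t) (newPos F (c t) (a t) (b t)) * a') /
        (1 + c t * partialSnd (partialX F) (a t) (newPos F (c t) (a t) (b t)))) t := by
  have hu : DifferentiableAt ℝ (fun s => newPos F (c s) (a s) (b s)) t :=
    DifferentiableAt.comp (g := fun z : ℝ × ℝ × ℝ => newPos F (c z.1) z.2.1 z.2.2) t
      ((hF.contDiff_newPos hc hs).differentiable (by simp) (t, a t, b t)) (differentiableAt_id.prodMk (ha.differentiableAt.prodMk hb.differentiableAt))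
  have hu' := hu.hasDerivAt
  set u' := deriv (fun s => newPos F (c s) (a s) (b s)) t
  have hc' := (hc.differentiable (by simp) t).hasDerivAt
  have h1 := hu'.add (hc'.mul (hasDerivAt_comp₂ (contDiff_partialX hF.smooth) ha hu'))
  have h2 : HasDerivAt (fun s => a s + b s) _ t := h1.congr_of_eventuallyEq
    (Eventually.of_forall fun s => (hF.newPos_spec (hs s) (a s) (b s)).symm)
  have h3 := h2.unique (ha.add hb)
  have hpos := (hs t).pos (a t) (newPos F (c t) (a t) (b t))
  refine hu'.congr_deriv ?_
  rw [eq_div_iff hpos.ne']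
  linarith

/-- Differentiation of the equation defining the old position along a curve in `(X, V)`. -/
theorem hasDerivAt_oldPos (hF : IsDiagonalBump F R) (hl : IsSmallCoeff F l)
    {a b : ℝ → ℝ} {a' b' t : ℝ} (ha : HasDerivAt a a' t) (hb : HasDerivAt b b' t) :
    HasDerivAt (fun s => oldPos F l (a s) (b s))
      (((1 - l * partialSnd (partialSnd F) (oldPos F l (a t) (b t)) (a t)) * a' - b') /
        (1 + l * partialSnd (partialX F) (oldPos F l (a t) (b t)) (a t))) t := by
  have hu : DifferentiableAt ℝ (fun s => oldPos F l (a s) (b s)) t :=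
    DifferentiableAt.comp (g := fun z : ℝ × ℝ × ℝ => oldPos F l z.2.1 z.2.2) t
      ((hF.contDiff_oldPos (c := fun _ => l) contDiff_const
        (fun _ => hl)).differentiable (by simp) (t, a t, b t)) (differentiableAt_id.prodMk (ha.differentiableAt.prodMk hb.differentiableAt))
  have hu' := hu.hasDerivAt
  set u' := deriv (fun s => oldPos F l (a s) (b s)) t
  have h1 := hu'.add ((hasDerivAt_comp₂ (contDiff_partialSnd hF.smooth) hu' ha).const_mul l)
  have h2 : HasDerivAt (fun s => a s - b s) _ t := h1.congr_of_eventuallyEq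
    (Eventually.of_forall fun s => (hF.oldPos_spec hl (a s) (b s)).symm)
  have h3 := h2.unique (ha.sub hb)
  have hpos := hl.pos (oldPos F l (a t) (b t)) (a t)
  rw [partialX_partialSnd hF.smooth] at h3
  refine hu'.congr_deriv ?_
  rw [eq_div_iff hpos.ne']
  linarith

theorem hasDerivAt_newPos_fst (hF : IsDiagonalBump F R) (hl : IsSmallCoeff F l) (x v : ℝ) :
    HasDerivAt (fun s => newPos F l s v)
      ((1 - l * partialX (partialX F) x (newPos F l x v)) /
        (1 + l * partialSnd (partialX F) x (newPos F l x v))) x := by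
  simpa using hF.hasDerivAt_newPos (c := fun _ => l) contDiff_const (fun _ => hl)
    (hasDerivAt_id x) (hasDerivAt_const x v)

theorem hasDerivAt_newPos_snd (hF : IsDiagonalBump F R) (hl : IsSmallCoeff F l) (x v : ℝ) :
    HasDerivAt (fun s => newPos F l x s)
      (1 / (1 + l * partialSnd (partialX F) x (newPos F l x v))) v := by
  simpa using hF.hasDerivAt_newPos (c := fun _ => l) contDiff_const (fun _ => hl)
    (hasDerivAt_const v x) (hasDerivAt_id v)

theorem hasDerivAt_newMom_fst (hF : IsDiagonalBump F R) {x v X' : ℝ}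
    (hX : HasDerivAt (fun s => newPos F l s v) X' x) :
    HasDerivAt (fun s => newMom F l s v)
      (X' - 1 - l * (partialSnd (partialX F) x (newPos F l x v)
        + partialSnd (partialSnd F) x (newPos F l x v) * X')) x := by
  have h := hasDerivAt_comp₂ (contDiff_partialSnd hF.smooth) (hasDerivAt_id x) hX
  exact ((hX.sub (hasDerivAt_id x)).sub (h.const_mul l)).congr_deriv
    (by simp [partialX_partialSnd hF.smooth])

theorem hasDerivAt_newMom_snd (hF : IsDiagonalBump F R) {x v X' : ℝ}
    (hX : HasDerivAt (fun s => newPos F l x s) X' v) :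
    HasDerivAt (fun s => newMom F l x s)
      (X' - l * (partialSnd (partialSnd F) x (newPos F l x v) * X')) v := by
  have h := hasDerivAt_comp₂ (contDiff_partialSnd hF.smooth) (hasDerivAt_const v x) hX
  exact ((hX.sub_const x).sub (h.const_mul l)).congr_deriv (by simp)

theorem jacobian_eq_one (hF : IsDiagonalBump F R) (hl : IsSmallCoeff F l) (x v : ℝ) :
    deriv (fun s => newPos F l s v) x * deriv (fun s => newMom F l x s) v
      - deriv (fun s => newPos F l x s) v * deriv (fun s => newMom F l s v) x = 1 := by
  have h1 := hF.hasDerivAt_newPos_fst hl x v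
  have h2 := hF.hasDerivAt_newPos_snd hl x v
  rw [(hF.hasDerivAt_newMom_fst h1).deriv, (hF.hasDerivAt_newMom_snd h2).deriv, h1.deriv,
    h2.deriv]
  have := (hl.pos x (newPos F l x v)).ne'
  field_simp
  ring

theorem deriv_newPos_snd_pos (hF : IsDiagonalBump F R) (hl : IsSmallCoeff F l) (x v : ℝ) :
    0 < deriv (fun s => newPos F l x s) v := by
  rw [(hF.hasDerivAt_newPos_snd hl x v).deriv]
  exact one_div_pos.2 (hl.pos x _)

end IsDiagonalBump

/-! ### The Hamiltonian of an isotopy of generated maps -/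

/-- The Hamilton–Jacobi Hamiltonian `(X, V) ↦ F(x, X)`, with `x` the old position, of the family
of generated maps with respect to the parameter `l`. -/
noncomputable def famHam (F : ℝ → ℝ → ℝ) (l X V : ℝ) : ℝ := F (oldPos F l X V) X

/-- The Hamiltonian of the isotopy `S_{t-1} ∘ Ψ_{c(t)}`, where `S_t (x, v) = (x + t v, v)` and `Ψ_l`
is the map generated by `(X - x)² / 2 - l F(x, X)`. -/
noncomputable def isotopyHam (F : ℝ → ℝ → ℝ) (c : ℝ → ℝ) (t q p : ℝ) : ℝ :=
  p ^ 2 / 2 + deriv c t * famHam F (c t) (q + (1 - t) * p) p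

/-- The isotopy `S_{t-1} ∘ Ψ_{c(t)}`. -/
noncomputable def isotopy (F : ℝ → ℝ → ℝ) (c : ℝ → ℝ) (p : ℝ × ℝ) (t : ℝ) : ℝ × ℝ :=
  (newPos F (c t) p.1 p.2 + (t - 1) * newMom F (c t) p.1 p.2, newMom F (c t) p.1 p.2)

namespace IsDiagonalBump

variable {F : ℝ → ℝ → ℝ} {R l : ℝ}

theorem hasDerivAt_famHam (hF : IsDiagonalBump F R) (hl : IsSmallCoeff F l)
    {a b : ℝ → ℝ} {a' b' t : ℝ} (ha : HasDerivAt a a' t) (hb : HasDerivAt b b' t) :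
    HasDerivAt (fun s => famHam F l (a s) (b s))
      (partialX F (oldPos F l (a t) (b t)) (a t) *
        (((1 - l * partialSnd (partialSnd F) (oldPos F l (a t) (b t)) (a t)) * a' - b') /
        (1 + l * partialSnd (partialX F) (oldPos F l (a t) (b t)) (a t)))
        + partialSnd F (oldPos F l (a t) (b t)) (a t) * a') t :=
  hasDerivAt_comp₂ hF.smooth (hF.hasDerivAt_oldPos hl ha hb) ha

/-- Hamilton's equations for the isotopy. -/
theorem hasDerivAt_isotopy (hF : IsDiagonalBump F R) {c : ℝ → ℝ} (hc : ContDiff ℝ ∞ c)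
    (hs : ∀ t, IsSmallCoeff F (c t)) (p : ℝ × ℝ) (t : ℝ) :
    HasDerivAt (isotopy F c p)
      (partialSnd (isotopyHam F c t) (isotopy F c p t).1 (isotopy F c p t).2,
        -partialX (isotopyHam F c t) (isotopy F c p t).1 (isotopy F c p t).2) t := by
  obtain ⟨x, v⟩ := p
  have hX := hF.hasDerivAt_newPos hc hs (hasDerivAt_const t x) (hasDerivAt_const t v)
  have hc' := (hc.differentiable (by simp) t).hasDerivAt
  have hV := (hX.sub_const x).sub
    (hc'.mul (hasDerivAt_comp₂ (contDiff_partialSnd hF.smooth) (hasDerivAt_const t x) hX))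
  change HasDerivAt (fun s => newMom F (c s) x v) _ t at hV
  have hγ := (hX.add (((hasDerivAt_id t).sub_const 1).mul hV)).prodMk hV
  refine HasDerivAt.congr_deriv (f := isotopy F c (x, v)) hγ ?_
  have hpos := ((hs t).pos x (newPos F (c t) x v)).ne'
  set X := newPos F (c t) x v
  set V := newMom F (c t) x v
  have hq : X + (t - 1) * V + (1 - t) * V = X := by ring
  have hold : oldPos F (c t) X V = x := hF.oldPos_newPos (hs t) x v
  have hHq : HasDerivAt (fun q => isotopyHam F c t q V) _ (X + (t - 1) * V) :=
    ((hF.hasDerivAt_famHam (hs t) ((hasDerivAt_id (X + (t - 1) * V)).add_const ((1 - t) * V))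
      (hasDerivAt_const _ V)).const_mul (deriv c t)).const_add (V ^ 2 / 2)
  have hHp : HasDerivAt (fun p => isotopyHam F c t (X + (t - 1) * V) p) _ V :=
    (((hasDerivAt_id V).pow 2).div_const 2).add
      ((hF.hasDerivAt_famHam (hs t)
        (((hasDerivAt_id V).const_mul (1 - t)).const_add (X + (t - 1) * V))
        (hasDerivAt_id V)).const_mul (deriv c t))
  simp only [id, hq, hold] at hHq hHp
  have e1 : (isotopy F c (x, v) t).1 = X + (t - 1) * V := rfl
  have e2 : (isotopy F c (x, v) t).2 = V := rfl
  have e3 : partialX (isotopyHam F c t) (X + (t - 1) * V) V = _ := hHq.deriv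
  have e4 : partialSnd (isotopyHam F c t) (X + (t - 1) * V) V = _ := hHp.deriv
  rw [e1, e2, e3, e4]
  simp only [Prod.mk.injEq, id]
  constructor
  · field_simp
    ring
  · field_simp
    ring

end IsDiagonalBump

end BraidTwist

namespace BraidTwist

namespace IsDiagonalBump

variable {F : ℝ → ℝ → ℝ} {R l : ℝ}

/-! ### Smoothness and convexity of the Hamiltonian -/

theorem famHam_eq_zero (hF : IsDiagonalBump F R) (hl : IsSmallCoeff F l) {X V : ℝ}
    (h : R ≤ |V|) : famHam F l X V = 0 := by
  have h0 := hF.eq_zero_sub X h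
  rw [famHam, hF.oldPos_of_eq_zero hl h0, h0]

theorem famHam_add_one (hF : IsDiagonalBump F R) (hl : IsSmallCoeff F l) (X V : ℝ) :
    famHam F l (X + 1) V = famHam F l X V := by
  rw [famHam, hF.oldPos_add_one hl, hF.periodic, famHam]

theorem contDiff_famHam (hF : IsDiagonalBump F R) {c : ℝ → ℝ} (hc : ContDiff ℝ ∞ c)
    (hs : ∀ t, IsSmallCoeff F (c t)) {E : Type*} [NormedAddCommGroup E] [NormedSpace ℝ E]
    {t a b : E → ℝ} (ht : ContDiff ℝ ∞ t) (ha : ContDiff ℝ ∞ a) (hb : ContDiff ℝ ∞ b) :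
    ContDiff ℝ ∞ (fun e => famHam F (c (t e)) (a e) (b e)) :=
  contDiff_comp₂ hF.smooth ((hF.contDiff_oldPos hc hs).comp (ht.prodMk (ha.prodMk hb))) ha

theorem contDiff_isotopyHam (hF : IsDiagonalBump F R) {c : ℝ → ℝ} (hc : ContDiff ℝ ∞ c)
    (hs : ∀ t, IsSmallCoeff F (c t)) :
    ContDiff ℝ ∞ (fun z : ℝ × ℝ × ℝ => isotopyHam F c z.1 z.2.1 z.2.2) := by
  have h1 : ContDiff ℝ ∞ (fun z : ℝ × ℝ × ℝ =>
      famHam F (c z.1) (z.2.1 + (1 - z.1) * z.2.2) z.2.2) :=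
    hF.contDiff_famHam hc hs (by fun_prop) (by fun_prop) (by fun_prop)
  have h2 : ContDiff ℝ ∞ (deriv c) := ContDiff.deriv' (by simpa using hc)
  unfold isotopyHam
  fun_prop

theorem isotopyHam_add_one (hF : IsDiagonalBump F R) {c : ℝ → ℝ}
    (hs : ∀ t, IsSmallCoeff F (c t)) (t q p : ℝ) :
    isotopyHam F c t (q + 1) p = isotopyHam F c t q p := by
  rw [isotopyHam, add_right_comm, hF.famHam_add_one (hs t), isotopyHam]

/-- The second derivative in the fibre direction of the sheared Hamiltonians of a
one-parameter family of generated maps is bounded: it is periodic in position and vanishes for large momentum. -/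
theorem exists_bound_famHam (hF : IsDiagonalBump F R) {c : ℝ → ℝ} (hc : ContDiff ℝ ∞ c)
    (hs : ∀ t, IsSmallCoeff F (c t)) :
    ∃ C, 0 ≤ C ∧ ∀ m ∈ Icc (0 : ℝ) 1, ∀ τ ∈ Icc (0 : ℝ) 1, ∀ q p,
      |partialSnd (partialSnd fun q p => famHam F (c m) (q + (1 - τ) * p) p) q p| ≤ C := by
  have hS : ContDiff ℝ ∞ (Function.uncurry fun (e : ℝ × ℝ × ℝ) (p : ℝ) =>
      famHam F (c e.1) (e.2.2 + (1 - e.2.1) * p) p) :=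
    hF.contDiff_famHam hc hs (by fun_prop) (by fun_prop) (by fun_prop)
  have hS2 := (contDiff_deriv_param (contDiff_deriv_param hS)).continuous
  obtain ⟨C, hC⟩ := ((isCompact_Icc.prod (isCompact_Icc.prod isCompact_Icc)).prod isCompact_Icc :
    IsCompact ((Icc (0 : ℝ) 1 ×ˢ Icc (0 : ℝ) 1 ×ˢ Icc (0 : ℝ) 1) ×ˢ
      Icc (-R) R)).exists_bound_of_continuousOn hS2.continuousOn
  refine ⟨max C 0, le_max_right _ _, fun m hm τ hτ q p => ?_⟩
  rcases lt_or_ge R |p| with h | h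
  · have h0 : (fun p => famHam F (c m) (q + (1 - τ) * p) p) =ᶠ[𝓝 p] fun _ => 0 := by
      filter_upwards [continuous_abs.continuousAt.eventually (lt_mem_nhds h)] with s hs'
      exact hF.famHam_eq_zero (hs m) hs'.le
    have h1 := h0.deriv
    have h2 : partialSnd (partialSnd fun q p => famHam F (c m) (q + (1 - τ) * p) p) q p = 0 := by
      exact h1.deriv_eq.trans (by simp)
    simp [h2]
  · have hper : Function.Periodic (fun q =>
        partialSnd (partialSnd fun q p => famHam F (c m) (q + (1 - τ) * p) p) q p) 1 := by
      intro q
      have : (fun p => famHam F (c m) (q + 1 + (1 - τ) * p) p) =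
          fun p => famHam F (c m) (q + (1 - τ) * p) p := by
        funext p
        rw [add_right_comm, hF.famHam_add_one (hs m)]
      have h2 : partialSnd (fun q p => famHam F (c m) (q + (1 - τ) * p) p) (q + 1) =
          partialSnd (fun q p => famHam F (c m) (q + (1 - τ) * p) p) q := by
        funext p
        rw [partialSnd, this, partialSnd]
      change deriv _ _ = deriv _ _
      rw [h2]
    obtain ⟨y, hy, hxy⟩ := hper.exists_mem_Ico₀ one_pos q
    rw [hxy]
    exact le_max_of_le_left (hC ((m, τ, y), p) ⟨⟨hm, hτ, hy.1, hy.2.le⟩, abs_le.1 h⟩)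

end IsDiagonalBump

/-- A smooth path of admissible coefficients, leading from `0` for `t ≤ 1/3` to `k` for
`t ≥ 2/3`. -/
structure IsCoeffPath (F : ℝ → ℝ → ℝ) (k : ℝ) (c : ℝ → ℝ) : Prop where
  smooth : ContDiff ℝ ∞ c
  small : ∀ t, IsSmallCoeff F (c t)
  eq_zero : ∀ t, t ≤ 1 / 3 → c t = 0
  eq_end : ∀ t, 2 / 3 ≤ t → c t = k

namespace IsDiagonalBump

variable {F : ℝ → ℝ → ℝ} {R k : ℝ} {c : ℝ → ℝ}

/-- For a small end value `k` there is a path of coefficients so slow that the isotopy it defines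
has a Hamiltonian convex in the momentum. -/
theorem exists_coeffPath (hF : IsDiagonalBump F R) :
    ∃ k₀ : ℝ, 0 < k₀ ∧ ∀ k, 0 ≤ k → k ≤ k₀ → ∃ c, IsCoeffPath F k c ∧
      ∀ t ∈ Icc (0 : ℝ) 1, ∀ q p, 0 < partialSnd (partialSnd (isotopyHam F c t)) q p := by
  obtain ⟨l₀, hl₀, hsmall⟩ := hF.exists_isSmallCoeff
  -- The sine turns the interval of admissible coefficients into a family over the whole line.
  have hsin : ∀ m, IsSmallCoeff F (l₀ * Real.sin m) := fun m => hsmall _ <| by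
    rw [abs_mul, abs_of_pos hl₀]
    exact mul_le_of_le_one_right hl₀.le (Real.abs_sin_le_one m)
  have hsinc : ContDiff ℝ ∞ (fun m => l₀ * Real.sin m) := by fun_prop
  obtain ⟨C, hC0, hC⟩ := hF.exists_bound_famHam hsinc hsin
  set β : ℝ → ℝ := fun t => Real.smoothTransition (3 * t - 1)
  have hβ : ContDiff ℝ ∞ β := Real.smoothTransition.contDiff.comp (by fun_prop)
  have hβ' : Continuous (deriv β) := hβ.continuous_deriv (by simp)
  obtain ⟨B, hB⟩ := (isCompact_Icc : IsCompact (Icc (0 : ℝ) 1)).exists_bound_of_continuousOn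
    hβ'.continuousOn
  have hB0 : 0 ≤ B := (norm_nonneg _).trans (hB 0 (by simp))
  -- The end value is `l₀ sin m` with `m ≤ m₀`; then `|c'| ≤ l₀ m₀ B`, and `l₀ m₀ B C < 1`.
  set m₀ : ℝ := 1 / (l₀ * B * C + 1)
  have hm₀ : 0 < m₀ := by positivity
  have hm₁ : m₀ ≤ 1 := by
    rw [div_le_one (by positivity)]
    linarith [show 0 ≤ l₀ * B * C by positivity]
  have hm₂ : l₀ * m₀ * B * C < 1 := by
    have : l₀ * m₀ * B * C = l₀ * B * C / (l₀ * B * C + 1) := by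
      simp only [m₀]
      ring
    rw [this, div_lt_one (by positivity)]
    linarith
  refine ⟨l₀ * Real.sin m₀, mul_pos hl₀ (Real.sin_pos_of_pos_of_le_one hm₀ hm₁),
    fun k hk0 hk => ?_⟩
  obtain ⟨m, ⟨hm0, hm⟩, hmk⟩ := intermediate_value_Icc hm₀.le hsinc.continuous.continuousOn
    (show k ∈ Icc _ _ by simpa using ⟨hk0, hk⟩)
  have hc : ContDiff ℝ ∞ (fun t => l₀ * Real.sin (m * β t)) := by fun_prop
  refine ⟨fun t => l₀ * Real.sin (m * β t), ⟨hc, fun t => hsin _, fun t ht => ?_, fun t ht => ?_⟩,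
    fun t ht q p => ?_⟩
  · simp [β, Real.smoothTransition.zero_of_nonpos (show 3 * t - 1 ≤ 0 by linarith)]
  · simpa [β, Real.smoothTransition.one_of_one_le (show 1 ≤ 3 * t - 1 by linarith)] using hmk
  · have hc' : HasDerivAt (fun t => l₀ * Real.sin (m * β t))
        (l₀ * (Real.cos (m * β t) * (m * deriv β t))) t :=
      (((hβ.differentiable (by simp) t).hasDerivAt.const_mul m).sin).const_mul l₀
    have hS : ContDiff ℝ ∞ (Function.uncurry fun q p =>
        famHam F (l₀ * Real.sin (m * β t)) (q + (1 - t) * p) p) :=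
      hF.contDiff_famHam (E := ℝ × ℝ) (t := fun _ => m * β t) hsinc hsin (by fun_prop)
        (by fun_prop) (by fun_prop)
    have e1 : partialSnd (isotopyHam F (fun t => l₀ * Real.sin (m * β t)) t) q = fun p =>
        p + deriv (fun t => l₀ * Real.sin (m * β t)) t * partialSnd (fun q p =>
          famHam F (l₀ * Real.sin (m * β t)) (q + (1 - t) * p) p) q p := by
      funext p
      have h := (((hasDerivAt_id p).pow 2).div_const 2).add
        ((hasDerivAt_snd hS q p).const_mul (deriv (fun t => l₀ * Real.sin (m * β t)) t))
      refine h.deriv.trans ?_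
      simp
    have e2 : partialSnd (partialSnd (isotopyHam F (fun t => l₀ * Real.sin (m * β t)) t)) q p =
        1 + deriv (fun t => l₀ * Real.sin (m * β t)) t * partialSnd (partialSnd (fun q p =>
          famHam F (l₀ * Real.sin (m * β t)) (q + (1 - t) * p) p)) q p := by
      rw [partialSnd, e1]
      exact ((hasDerivAt_id p).add ((hasDerivAt_snd (contDiff_partialSnd hS) q p).const_mul
        (deriv (fun t => l₀ * Real.sin (m * β t)) t))).deriv
    have hmβ : m * β t ∈ Icc (0 : ℝ) 1 := by
      have h0 : 0 ≤ β t := Real.smoothTransition.nonneg _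
      have h1 : β t ≤ 1 := Real.smoothTransition.le_one _
      exact ⟨by positivity, mul_le_one₀ (hm.trans hm₁) h0 h1⟩
    have hd : |deriv (fun t => l₀ * Real.sin (m * β t)) t| ≤ l₀ * m₀ * B := by
      rw [hc'.deriv, abs_mul, abs_mul, abs_mul, abs_of_pos hl₀, abs_of_nonneg hm0]
      calc l₀ * (|Real.cos (m * β t)| * (m * |deriv β t|)) ≤ l₀ * (1 * (m₀ * B)) := by
            gcongr
            · exact Real.abs_cos_le_one _
            · exact hB t ht
        _ = l₀ * m₀ * B := by ring
    have hprod := mul_le_mul hd (hC _ hmβ t ht q p) (abs_nonneg _) (by positivity)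
    rw [← abs_mul] at hprod
    rw [e2]
    linarith [(abs_le.1 hprod).1]

end IsDiagonalBump

/-! ### Periodic extension in time -/

/-- Near `t₀` the integer part is that of `t₀`, or less by one; in the latter case `t` lies shortly
before `⌊t₀⌋`. -/
theorem eventually_floor_eq_or (t₀ : ℝ) :
    ∀ᶠ t : ℝ in 𝓝 t₀, ⌊t⌋ = ⌊t₀⌋ ∨ ⌊t⌋ = ⌊t₀⌋ - 1 ∧ t - ⌊t₀⌋ < 0 ∧ 2 / 3 < t - ⌊t₀⌋ + 1 := by
  have h1 := Int.floor_le t₀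
  have h2 := Int.lt_floor_add_one t₀
  filter_upwards [lt_mem_nhds (show (⌊t₀⌋ : ℝ) - 1 / 3 < t₀ by linarith), gt_mem_nhds h2]
    with t ht1 ht2
  rcases le_or_gt (⌊t₀⌋ : ℝ) t with h | h
  · exact .inl (Int.floor_eq_iff.2 ⟨h, ht2⟩)
  · refine .inr ⟨Int.floor_eq_iff.2 ⟨?_, ?_⟩, by linarith, by linarith⟩ <;> push_cast <;> linarith

/-- The Hamiltonian of the isotopy on the time interval `[0, 1)`, extended periodically. -/
noncomputable def periodicHam (F : ℝ → ℝ → ℝ) (c : ℝ → ℝ) (t q p : ℝ) : ℝ :=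
  isotopyHam F c (Int.fract t) q p

namespace IsCoeffPath

variable {F : ℝ → ℝ → ℝ} {R k : ℝ} {c : ℝ → ℝ}

theorem small_end (hc : IsCoeffPath F k c) : IsSmallCoeff F k := by
  have := hc.small 1
  rwa [hc.eq_end 1 (by norm_num)] at this

theorem isotopyHam_of_lt (hc : IsCoeffPath F k c) {t : ℝ} (ht : t < 1 / 3) (q p : ℝ) :
    isotopyHam F c t q p = p ^ 2 / 2 := by
  have : c =ᶠ[𝓝 t] fun _ => 0 := by
    filter_upwards [gt_mem_nhds ht] with s hs using hc.eq_zero s hs.le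
  rw [isotopyHam, this.deriv_eq]
  simp

theorem isotopyHam_of_gt (hc : IsCoeffPath F k c) {t : ℝ} (ht : 2 / 3 < t) (q p : ℝ) :
    isotopyHam F c t q p = p ^ 2 / 2 := by
  have : c =ᶠ[𝓝 t] fun _ => k := by
    filter_upwards [lt_mem_nhds ht] with s hs using hc.eq_end s hs.le
  rw [isotopyHam, this.deriv_eq]
  simp

theorem isotopy_of_le (hF : IsDiagonalBump F R) (hc : IsCoeffPath F k c) {t : ℝ} (ht : t ≤ 1 / 3)
    (p : ℝ × ℝ) : isotopy F c p t = (p.1 + t * p.2, p.2) := by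
  have hs := hc.small t
  have h0 := hc.eq_zero t ht
  rw [h0] at hs
  have h1 : newPos F 0 p.1 p.2 = p.1 + p.2 := by simpa using hF.newPos_spec hs p.1 p.2
  have h2 : newMom F 0 p.1 p.2 = p.2 := by simp [newMom, h1]
  rw [isotopy, h0, h1, h2]
  ext <;> simp
  ring

theorem isotopy_of_ge (hF : IsDiagonalBump F R) (hc : IsCoeffPath F k c) {t : ℝ} (ht : 2 / 3 ≤ t)
    (p : ℝ × ℝ) : isotopy F c p t =
      ((hF.twistEquiv hc.small_end p).1 + (t - 1) * (hF.twistEquiv hc.small_end p).2,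
        (hF.twistEquiv hc.small_end p).2) := by
  rw [isotopy, hc.eq_end t ht, hF.twistEquiv_apply]

theorem contDiff_periodicHam (hF : IsDiagonalBump F R) (hc : IsCoeffPath F k c) :
    ContDiff ℝ ∞ (fun z : ℝ × ℝ × ℝ => periodicHam F c z.1 z.2.1 z.2.2) := by
  rw [contDiff_iff_contDiffAt]
  intro z
  have h : ContDiff ℝ ∞ (fun w : ℝ × ℝ × ℝ => isotopyHam F c (w.1 - ⌊z.1⌋) w.2.1 w.2.2) :=
    (hF.contDiff_isotopyHam hc.smooth hc.small).comp
      (by fun_prop : ContDiff ℝ ∞ (fun w : ℝ × ℝ × ℝ => (w.1 - (⌊z.1⌋ : ℝ), w.2.1, w.2.2)))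
  refine h.contDiffAt.congr_of_eventuallyEq ?_
  filter_upwards [continuous_fst.continuousAt.eventually (eventually_floor_eq_or z.1)] with w hw
  -- Just before an integer time the formulas of both adjacent periods give the free Hamiltonian.
  rcases hw with hw | ⟨hw, h1, h2⟩
  · rw [periodicHam, Int.fract, hw]
  · have hfr : Int.fract w.1 = w.1 - ⌊z.1⌋ + 1 := by
      rw [Int.fract, hw]
      push_cast
      ring
    rw [periodicHam, hfr, hc.isotopyHam_of_gt h2, hc.isotopyHam_of_lt (by linarith)]

end IsCoeffPath

/-- The trajectory through `p` of the flow of `periodicHam F c`. It runs along the isotopy between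
consecutive points of the orbit of `p` under the time-one map. -/
noncomputable def trajectory (F : ℝ → ℝ → ℝ) (c : ℝ → ℝ) (e : Equiv.Perm (ℝ × ℝ)) (p : ℝ × ℝ)
    (t : ℝ) : ℝ × ℝ :=
  isotopy F c ((e ^ ⌊t⌋) p) (Int.fract t)

namespace IsCoeffPath

variable {F : ℝ → ℝ → ℝ} {R k : ℝ} {c : ℝ → ℝ}

theorem trajectory_zero (hF : IsDiagonalBump F R) (hc : IsCoeffPath F k c)
    (e : Equiv.Perm (ℝ × ℝ)) (p : ℝ × ℝ) : trajectory F c e p 0 = p := by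
  simp [trajectory, hc.isotopy_of_le hF (show (0 : ℝ) ≤ 1 / 3 by norm_num)]

theorem trajectory_one (hF : IsDiagonalBump F R) (hc : IsCoeffPath F k c)
    (e : Equiv.Perm (ℝ × ℝ)) (p : ℝ × ℝ) : trajectory F c e p 1 = e p := by
  simp [trajectory, hc.isotopy_of_le hF (show (0 : ℝ) ≤ 1 / 3 by norm_num)]

theorem hasDerivAt_trajectory (hF : IsDiagonalBump F R) (hc : IsCoeffPath F k c) (p : ℝ × ℝ)
    (t : ℝ) :
    HasDerivAt (trajectory F c (hF.twistEquiv hc.small_end) p)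
      (partialSnd (periodicHam F c t)
        (trajectory F c (hF.twistEquiv hc.small_end) p t).1
        (trajectory F c (hF.twistEquiv hc.small_end) p t).2,
      -partialX (periodicHam F c t)
        (trajectory F c (hF.twistEquiv hc.small_end) p t).1
        (trajectory F c (hF.twistEquiv hc.small_end) p t).2) t := by
  set e := hF.twistEquiv hc.small_end with he
  have h := (hF.hasDerivAt_isotopy hc.smooth hc.small ((e ^ ⌊t⌋) p) (t - ⌊t⌋)).comp_sub_const t
    (⌊t⌋ : ℝ)
  refine HasDerivAt.congr_of_eventuallyEq h ?_
  filter_upwards [eventually_floor_eq_or t] with s hs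
  rcases hs with hs | ⟨hs, h1, h2⟩
  · rw [trajectory, Int.fract, hs]
  · have hfr : Int.fract s = s - ⌊t⌋ + 1 := by
      rw [Int.fract, hs]
      push_cast
      ring
    have hpow : e ((e ^ (⌊t⌋ - 1)) p) = (e ^ ⌊t⌋) p := by
      rw [← Equiv.Perm.mul_apply, ← zpow_one_add, add_sub_cancel]
    rw [trajectory, hfr, hc.isotopy_of_ge hF h2.le, hs, ← he, hpow,
      hc.isotopy_of_le hF (by linarith), add_sub_cancel_right]

end IsCoeffPath

namespace IsDiagonalBump

variable {F : ℝ → ℝ → ℝ} {R l : ℝ}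

theorem newMom_mem_Icc_iff (hF : IsDiagonalBump F R) (hl : IsSmallCoeff F l) {a b : ℝ}
    (ha : R ≤ |a|) (hb : R ≤ |b|) (x v : ℝ) : newMom F l x v ∈ Icc a b ↔ v ∈ Icc a b := by
  rcases hF.newMom_eq_or hl x v with h | ⟨h1, h2⟩
  · rw [h]
  · rw [abs_lt] at h1 h2
    simp only [mem_Icc]
    rcases le_abs.1 ha with ha | ha <;> rcases le_abs.1 hb with hb | hb <;>
      constructor <;> rintro ⟨h3, h4⟩ <;> constructor <;> linarith

theorem trajectory_mem_Icc (hF : IsDiagonalBump F R) {k : ℝ} {c : ℝ → ℝ}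
    (hc : IsCoeffPath F k c) {a b : ℝ} (ha : R ≤ |a|) (hb : R ≤ |b|) {p : ℝ × ℝ}
    (hp : p.2 ∈ Icc a b) (t : ℝ) :
    (trajectory F c (hF.twistEquiv hc.small_end) p t).2 ∈ Icc a b := by
  have key : ∀ n : ℤ, ((hF.twistEquiv hc.small_end ^ n) p).2 ∈ Icc a b := by
    intro n
    induction n using Int.induction_on with
    | zero => simpa using hp
    | succ n ih =>
      rw [add_comm, zpow_one_add, Equiv.Perm.mul_apply, twistEquiv_apply]
      exact (hF.newMom_mem_Icc_iff hc.small_end ha hb _ _).2 ih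
    | pred n ih =>
      rw [show -(n : ℤ) = 1 + (-n - 1) by ring, zpow_one_add, Equiv.Perm.mul_apply,
        twistEquiv_apply] at ih
      exact (hF.newMom_mem_Icc_iff hc.small_end ha hb _ _).1 ih
  exact (hF.newMom_mem_Icc_iff (hc.small _) ha hb _ _).2 (key _)

end IsDiagonalBump

end BraidTwist

namespace BraidTwist

/-! ### Hamiltonians on a strip -/

/-- Solutions of a smooth time-dependent system on `[0, 1]` are determined by their initial
values. -/
theorem solution_unique {E : Type*} [NormedAddCommGroup E] [NormedSpace ℝ E] {v : ℝ → E → E}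
    (hv : ContDiff ℝ 1 (Function.uncurry v)) {f g : ℝ → E}
    (hf : ∀ t ∈ Icc (0 : ℝ) 1, HasDerivWithinAt f (v t (f t)) (Icc 0 1) t)
    (hg : ∀ t ∈ Icc (0 : ℝ) 1, HasDerivWithinAt g (v t (g t)) (Icc 0 1) t)
    (h0 : f 0 = g 0) : f 1 = g 1 := by
  have hfc : ContinuousOn f (Icc 0 1) := fun t ht => (hf t ht).continuousWithinAt
  have hgc : ContinuousOn g (Icc 0 1) := fun t ht => (hg t ht).continuousWithinAt
  -- The two solutions stay in a compact set, on which the vector field is Lipschitz.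
  set S : Set E := f '' Icc 0 1 ∪ g '' Icc 0 1
  have hS : IsCompact S := (isCompact_Icc.image_of_continuousOn hfc).union
    (isCompact_Icc.image_of_continuousOn hgc)
  obtain ⟨K, hK⟩ := (hv.locallyLipschitz.locallyLipschitzOn).exists_lipschitzOnWith_of_compact
    ((isCompact_Icc : IsCompact (Icc (0 : ℝ) 1)).prod hS)
  have hvK : ∀ t ∈ Ico (0 : ℝ) 1, LipschitzOnWith K (v t) S := by
    intro t ht
    have h1 : LipschitzOnWith 1 (fun x : E => (t, x)) S :=
      (LipschitzWith.prodMk_left t).lipschitzOnWith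
    have h2 := hK.comp h1 fun x hx => ⟨Ico_subset_Icc_self ht, hx⟩
    rwa [mul_one] at h2
  have hder : ∀ {u : ℝ → E}, (∀ t ∈ Icc (0 : ℝ) 1, HasDerivWithinAt u (v t (u t)) (Icc 0 1) t) →
      ∀ t ∈ Ico (0 : ℝ) 1, HasDerivWithinAt u (v t (u t)) (Ici t) t := fun hu t ht =>
    (hu t (Ico_subset_Icc_self ht)).mono_of_mem_nhdsWithin (Icc_mem_nhdsGE_of_mem ht)
  exact ODE_solution_unique_of_mem_Icc_right (s := fun _ => S) hvK hfc (hder hf)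
    (fun t ht => .inl ⟨t, Ico_subset_Icc_self ht, rfl⟩) hgc (hder hg)
    (fun t ht => .inr ⟨t, Ico_subset_Icc_self ht, rfl⟩) h0 (by simp)

theorem partialY_eq_partialSnd {a b : ℝ} (hab : a < b) {G : ℝ → ℝ → ℝ}
    (hG : ContDiff ℝ ∞ (Function.uncurry G)) (x : ℝ) {y : ℝ} (hy : y ∈ Icc a b) :
    partialY a b G x y = partialSnd G x y :=
  (hasDerivAt_snd hG x y).differentiableAt.derivWithin (uniqueDiffOn_Icc hab y hy)

theorem partialY_partialY_eq {a b : ℝ} (hab : a < b) {G : ℝ → ℝ → ℝ}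
    (hG : ContDiff ℝ ∞ (Function.uncurry G)) (x : ℝ) {y : ℝ} (hy : y ∈ Icc a b) :
    partialY a b (partialY a b G) x y = partialSnd (partialSnd G) x y := by
  rw [← partialY_eq_partialSnd hab (contDiff_partialSnd hG) x hy]
  exact derivWithin_congr (fun s hs => partialY_eq_partialSnd hab hG x hs)
    (partialY_eq_partialSnd hab hG x hy)

/-- A Hamiltonian that is smooth on the whole space has the required properties on a strip as soon
as every point of the strip has a complete trajectory in the strip: the trajectories are
unique. -/
theorem isHamiltonianFor_of_contDiff {σ a b : ℝ} (hab : a < b) {φ : ℝ × ℝ → ℝ × ℝ}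
    {H : ℝ → ℝ → ℝ → ℝ} (hH : ContDiff ℝ ∞ (fun z : ℝ × ℝ × ℝ => H z.1 z.2.1 z.2.2))
    (htime : ∀ t x y, H (t + 1) x y = H t x y) (hspace : ∀ t x y, H t (x + 1) y = H t x y)
    (hleft : ∀ t x, partialX (H t) x a = 0) (hright : ∀ t x, partialX (H t) x b = 0)
    (hconv : ∀ t x y, 0 < σ * partialSnd (partialSnd (H t)) x y)
    (hflow : ∀ p : ℝ × ℝ, p.2 ∈ Icc a b → ∃ γ : ℝ → ℝ × ℝ, γ 0 = p ∧ γ 1 = φ p ∧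
      ∀ t, (γ t).2 ∈ Icc a b ∧ HasDerivAt γ
        (partialSnd (H t) (γ t).1 (γ t).2, -partialX (H t) (γ t).1 (γ t).2) t) :
    IsHamiltonianFor σ a b φ H := by
  have hHt : ∀ t, ContDiff ℝ ∞ (Function.uncurry (H t)) := fun t =>
    hH.comp (by fun_prop : ContDiff ℝ ∞ (fun w : ℝ × ℝ => (t, w.1, w.2)))
  refine ⟨hH.contDiffOn, fun t x y _ => htime t x y, fun t x y _ => hspace t x y, hleft, hright,
    fun t x y hy => ?_, fun p hp => ?_, fun γ hγ => ?_⟩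
  · rw [partialY_partialY_eq hab (hHt t) x hy]
    exact hconv t x y
  · obtain ⟨γ, h0, -, hγ⟩ := hflow p hp
    refine ⟨γ, h0, fun t _ => ⟨(hγ t).1, ?_⟩⟩
    rw [partialY_eq_partialSnd hab (hHt t) _ (hγ t).1]
    exact (hγ t).2.hasDerivWithinAt
  · obtain ⟨η, h0, h1, hη⟩ := hflow (γ 0) (hγ 0 (by simp)).1
    have hv : ContDiff ℝ ∞ (Function.uncurry fun (t : ℝ) (p : ℝ × ℝ) =>
        (partialSnd (H t) p.1 p.2, -partialX (H t) p.1 p.2)) := by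
      have e1 : ContDiff ℝ ∞ (Function.uncurry fun (e : ℝ × ℝ) (y : ℝ) => H e.1 e.2 y) :=
        hH.comp (by fun_prop : ContDiff ℝ ∞ (fun w : (ℝ × ℝ) × ℝ => (w.1.1, w.1.2, w.2)))
      have e2 : ContDiff ℝ ∞ (Function.uncurry fun (e : ℝ × ℝ) (x : ℝ) => H e.1 x e.2) :=
        hH.comp (by fun_prop : ContDiff ℝ ∞ (fun w : (ℝ × ℝ) × ℝ => (w.1.1, w.2, w.1.2)))
      have d1 := (contDiff_deriv_param e1).comp
        (by fun_prop : ContDiff ℝ ∞ (fun w : ℝ × ℝ × ℝ => ((w.1, w.2.1), w.2.2)))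
      have d2 := (contDiff_deriv_param e2).comp
        (by fun_prop : ContDiff ℝ ∞ (fun w : ℝ × ℝ × ℝ => ((w.1, w.2.2), w.2.1)))
      exact d1.prodMk d2.neg
    rw [← h1]
    refine solution_unique (hv.of_le (by simp)) (fun t ht => ?_)
      (fun t _ => (hη t).2.hasDerivWithinAt) h0.symm
    have := (hγ t ht).2
    rwa [partialY_eq_partialSnd hab (hHt t) _ (hγ t ht).1] at this

/-! ### Rescaling the momentum -/

/-- The map generated by `(X - x)² / 2 - l F(x, X)` in the coordinates `(x, y)`, `v = s y`. -/
noncomputable def scaledMap (F : ℝ → ℝ → ℝ) (s l : ℝ) (p : ℝ × ℝ) : ℝ × ℝ :=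
  (newPos F l p.1 (s * p.2), newMom F l p.1 (s * p.2) / s)

theorem mul_mem_uIcc_iff {s a b y : ℝ} (hs : s ≠ 0) (hab : a < b) :
    s * y ∈ uIcc (s * a) (s * b) ↔ y ∈ Icc a b := by
  rcases hs.lt_or_gt with h | h
  · rw [uIcc_of_ge (mul_le_mul_of_nonpos_left hab.le h.le), mem_Icc, mem_Icc,
      mul_le_mul_left_of_neg h, mul_le_mul_left_of_neg h, and_comm]
  · rw [uIcc_of_le (by gcongr), mem_Icc, mem_Icc, mul_le_mul_iff_right₀ h,
      mul_le_mul_iff_right₀ h]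

namespace IsDiagonalBump

variable {F : ℝ → ℝ → ℝ} {R l : ℝ}

theorem contDiff_scaledMap (hF : IsDiagonalBump F R) (hl : IsSmallCoeff F l) (s : ℝ) :
    ContDiff ℝ ∞ (scaledMap F s l) := by
  have h1 := (hF.contDiff_newPos (c := fun _ => l) contDiff_const fun _ => hl).comp
    (by fun_prop : ContDiff ℝ ∞ (fun p : ℝ × ℝ => ((0 : ℝ), p.1, s * p.2)))
  have h2 := (hF.contDiff_newMom (c := fun _ => l) contDiff_const fun _ => hl).comp
    (by fun_prop : ContDiff ℝ ∞ (fun p : ℝ × ℝ => ((0 : ℝ), p.1, s * p.2)))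
  exact h1.prodMk (h2.div_const s)

theorem isMonotoneTwist_scaledMap (hF : IsDiagonalBump F R) (hl : IsSmallCoeff F l)
    {σ s a b : ℝ} (hs : 0 < σ * s) (hab : a < b) (ha : R ≤ |s * a|) (hb : R ≤ |s * b|) :
    IsMonotoneTwist σ a b (scaledMap F s l) := by
  have hs0 : s ≠ 0 := right_ne_zero_of_mul hs.ne'
  have hψ := hF.contDiff_scaledMap hl s
  have h1 : ContDiff ℝ ∞ (Function.uncurry fun x y => (scaledMap F s l (x, y)).1) := hψ.fst
  have h2 : ContDiff ℝ ∞ (Function.uncurry fun x y => (scaledMap F s l (x, y)).2) := hψ.snd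
  have d1 : ∀ x y, partialSnd (fun x y => (scaledMap F s l (x, y)).1) x y =
      s * deriv (fun v => newPos F l x v) (s * y) := fun x y => by
    exact deriv_comp_mul_left s (fun v => newPos F l x v) y
  have d2 : ∀ x y, partialSnd (fun x y => (scaledMap F s l (x, y)).2) x y =
      deriv (fun v => newMom F l x v) (s * y) := fun x y => by
    have := deriv_comp_mul_left s (fun v => newMom F l x v) y
    simp only [partialSnd, scaledMap, deriv_div_const, this, smul_eq_mul]
    field_simp
  have hbdry : ∀ x y, R ≤ |s * y| → (scaledMap F s l (x, y)).2 = y := fun x y hy => by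
    simp only [scaledMap]
    rw [hF.newMom_of_eq_zero hl (hF.eq_zero_add x hy)]
    field_simp
  refine ⟨hψ.contDiffOn, fun x y hy => ?_, fun x y _ => hF.newPos_add_one hl _ _,
    fun x y _ => congrArg (· / s) (hF.newMom_add_one hl _ _), fun x => hbdry x a ha,
    fun x => hbdry x b hb, fun x y hy => ?_⟩
  · rw [partialY_eq_partialSnd hab h1 x hy, partialY_eq_partialSnd hab h2 x hy, d1, d2]
    simp only [partialX, scaledMap, deriv_div_const]
    rw [← hF.jacobian_eq_one hl x (s * y)]
    field_simp
  · rw [partialY_eq_partialSnd hab h1 x hy, d1, ← mul_assoc]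
    exact mul_pos hs (hF.deriv_newPos_snd_pos hl x _)

/-- For small `l`, the generated map is the time-one map of a Hamiltonian convex in the momentum,
on every strip with boundary lines off the support of the perturbation. -/
theorem exists_isHamiltonianFor (hF : IsDiagonalBump F R) :
    ∃ k₀ : ℝ, 0 < k₀ ∧ ∀ k, 0 ≤ k → k ≤ k₀ → IsSmallCoeff F k ∧
      ∀ σ s a b : ℝ, 0 < σ * s → a < b → R ≤ |s * a| → R ≤ |s * b| →
        ∃ H, IsHamiltonianFor σ a b (scaledMap F s k) H := by
  obtain ⟨k₀, hk₀, h⟩ := hF.exists_coeffPath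
  refine ⟨k₀, hk₀, fun k hk0 hk => ?_⟩
  obtain ⟨c, hc, hconv⟩ := h k hk0 hk
  refine ⟨hc.small_end, fun σ s a b hs hab ha hb => ?_⟩
  have hs0 : s ≠ 0 := right_ne_zero_of_mul hs.ne'
  have hH := hc.contDiff_periodicHam hF
  have hHt : ∀ t, ContDiff ℝ ∞ (Function.uncurry (periodicHam F c t)) := fun t =>
    hH.comp (by fun_prop : ContDiff ℝ ∞ (fun w : ℝ × ℝ => (t, w.1, w.2)))
  set H : ℝ → ℝ → ℝ → ℝ := fun t x y => periodicHam F c t x (s * y) / s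
  have dX : ∀ t x y, partialX (H t) x y = partialX (periodicHam F c t) x (s * y) / s :=
    fun t x y => by simp only [partialX, H, deriv_div_const]
  have dY : ∀ t x y, partialSnd (H t) x y = partialSnd (periodicHam F c t) x (s * y) :=
    fun t x y => by
      have := deriv_comp_mul_left s (periodicHam F c t x) y
      simp only [partialSnd, H, deriv_div_const, this, smul_eq_mul]
      field_simp
  have hbdry : ∀ t x y, R ≤ |s * y| → partialX (H t) x y = 0 := fun t x y hy => by
    have : (fun q => periodicHam F c t q (s * y)) = fun _ => (s * y) ^ 2 / 2 := by
      funext q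
      rw [periodicHam, isotopyHam, hF.famHam_eq_zero (hc.small _) hy]
      ring
    rw [dX, partialX, this, deriv_const, zero_div]
  refine ⟨H, isHamiltonianFor_of_contDiff hab ?_ (fun t x y => ?_) (fun t x y => ?_)
    (fun t x => hbdry t x a ha) (fun t x => hbdry t x b hb) (fun t x y => ?_) (fun p hp => ?_)⟩
  · exact (hH.comp (by fun_prop : ContDiff ℝ ∞
      (fun w : ℝ × ℝ × ℝ => (w.1, w.2.1, s * w.2.2)))).div_const s
  · simp only [H, periodicHam, Int.fract_add_one]
  · simp only [H, periodicHam, hF.isotopyHam_add_one hc.small]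
  · have e : partialSnd (partialSnd (H t)) x y =
        s * partialSnd (partialSnd (periodicHam F c t)) x (s * y) := by
      have := deriv_comp_mul_left s (partialSnd (periodicHam F c t) x) y
      have e1 : partialSnd (H t) x = fun y => partialSnd (periodicHam F c t) x (s * y) :=
        funext (dY t x)
      rw [partialSnd, e1, this, smul_eq_mul, partialSnd]
    rw [e, ← mul_assoc]
    exact mul_pos hs (hconv _ ⟨Int.fract_nonneg t, (Int.fract_lt_one t).le⟩ _ _)
  · set q : ℝ × ℝ := (p.1, s * p.2)
    set γ := trajectory F c (hF.twistEquiv hc.small_end) q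
    have ha' : R ≤ |min (s * a) (s * b)| := by
      rcases min_choice (s * a) (s * b) with h | h <;> rwa [h]
    have hb' : R ≤ |max (s * a) (s * b)| := by
      rcases max_choice (s * a) (s * b) with h | h <;> rwa [h]
    have hq : q.2 ∈ Icc (min (s * a) (s * b)) (max (s * a) (s * b)) :=
      (mul_mem_uIcc_iff hs0 hab).2 hp
    refine ⟨fun t => ((γ t).1, (γ t).2 / s), ?_, ?_, fun t => ⟨?_, ?_⟩⟩
    · have : γ 0 = q := hc.trajectory_zero hF _ q
      simp [this, q, hs0]
    · have : γ 1 = hF.twistEquiv hc.small_end q := hc.trajectory_one hF _ q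
      simp [this, q, hF.twistEquiv_apply, scaledMap]
    · rw [← mul_mem_uIcc_iff hs0 hab, mul_div_cancel₀ _ hs0]
      exact hF.trajectory_mem_Icc hc ha' hb' hq t
    · have hd := hc.hasDerivAt_trajectory hF q t
      rw [dX, dY, mul_div_cancel₀ _ hs0, ← neg_div]
      have h1 := hd.hasFDerivAt.fst.hasDerivAt
      have h2 := hd.hasFDerivAt.snd.hasDerivAt
      simp only [ContinuousLinearMap.comp_apply, ContinuousLinearMap.toSpanSingleton_apply,
        one_smul, ContinuousLinearMap.coe_fst', ContinuousLinearMap.coe_snd'] at h1 h2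
      exact h1.prodMk (h2.div_const s)

end IsDiagonalBump

end BraidTwist

namespace BraidTwist

/-! ### The perturbation supported near the lattice points -/

/-- The function `F(x, X) = ½ ∑ₖ c_ε(rₖ) rₖ`, with `rₖ` the squared distance of `(x, X)` from
`(k, k)`. The generating function of the theorem is `(x - X)² / (2 sin θ) - tan (θ/2) F(x, X)`. -/
noncomputable def latticeBump (ε x X : ℝ) : ℝ := 1 / 2 * ∑ᶠ k : ℤ, cutoff ε (sqDist k x X) * sqDist k x X

variable {ε : ℝ}

theorem sqDist_nonneg (k : ℤ) (x X : ℝ) : 0 ≤ sqDist k x X := by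
  unfold sqDist
  positivity

theorem cutoff_nonneg (ε t : ℝ) : 0 ≤ cutoff ε t := Real.smoothTransition.nonneg _

theorem cutoff_eq_zero (hε : 0 < ε) {t : ℝ} (ht : 2 * ε ≤ t) : cutoff ε t = 0 := by
  apply Real.smoothTransition.zero_of_nonpos
  have : 2 ≤ t / ε := (le_div_iff₀ hε).2 ht
  rw [neg_div]
  linarith

theorem cutoff_eq_one (hε : 0 < ε) {t : ℝ} (ht : t ≤ ε) : cutoff ε t = 1 := by
  apply Real.smoothTransition.one_of_one_le
  have : t / ε ≤ 1 := (div_le_one hε).2 ht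
  rw [neg_div]
  linarith

theorem contDiff_cutoff (ε : ℝ) : ContDiff ℝ ∞ (cutoff ε) :=
  Real.smoothTransition.contDiff.comp (by fun_prop)

theorem latticeBump_nonneg (ε x X : ℝ) : 0 ≤ latticeBump ε x X :=
  mul_nonneg (by norm_num)
    (finsum_nonneg fun k => mul_nonneg (cutoff_nonneg _ _) (sqDist_nonneg k x X))

theorem latticeBump_eq_zero (hε : 0 < ε) {x X : ℝ} (h : ∀ k : ℤ, 2 * ε ≤ sqDist k x X) :
    latticeBump ε x X = 0 := by
  simp [latticeBump, cutoff_eq_zero hε (h _)]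

theorem latticeBump_eq_half_sqDist (hε : 0 < ε) {x X : ℝ} (k : ℤ) (h : sqDist k x X ≤ ε)
    (h' : ∀ j : ℤ, j ≠ k → 2 * ε ≤ sqDist j x X) : latticeBump ε x X = sqDist k x X / 2 := by
  rw [latticeBump, finsum_eq_single _ k fun j hj => by rw [cutoff_eq_zero hε (h' j hj), zero_mul],
    cutoff_eq_one hε h]
  ring

theorem latticeBump_periodic (ε x X : ℝ) : latticeBump ε (x + 1) (X + 1) = latticeBump ε x X := by
  have h : ∀ k : ℤ, sqDist (k + 1) (x + 1) (X + 1) = sqDist k x X := fun k => by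
    unfold sqDist
    push_cast
    ring
  rw [latticeBump, latticeBump, ← finsum_comp_equiv (Equiv.addRight (1 : ℤ))]
  simp [h]

theorem contDiff_latticeBump (hε : 0 < ε) :
    ContDiff ℝ ∞ (Function.uncurry (latticeBump ε)) := by
  have hterm : ∀ k : ℤ, ContDiff ℝ ∞ fun p : ℝ × ℝ =>
      cutoff ε (sqDist k p.1 p.2) * sqDist k p.1 p.2 := fun k => by
    have h1 : ContDiff ℝ ∞ fun p : ℝ × ℝ => sqDist k p.1 p.2 := by
      unfold sqDist
      fun_prop
    exact ((contDiff_cutoff ε).comp h1).mul h1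
  have hlf : LocallyFinite fun k : ℤ => Function.support fun p : ℝ × ℝ =>
      cutoff ε (sqDist k p.1 p.2) * sqDist k p.1 p.2 := by
    intro p₀
    refine ⟨{p | p.1 ∈ Ioo (p₀.1 - 1) (p₀.1 + 1)},
      (isOpen_Ioo.preimage continuous_fst).mem_nhds ⟨by linarith, by linarith⟩, ?_⟩
    refine (finite_Icc ⌊p₀.1 - 1 - √(2 * ε)⌋ ⌈p₀.1 + 1 + √(2 * ε)⌉).subset ?_
    rintro k ⟨p, hp, hp1, hp2⟩
    have hlt : sqDist k p.1 p.2 < 2 * ε := by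
      by_contra! h
      exact hp (by simp [cutoff_eq_zero hε h])
    have habs : |p.1 - k| < √(2 * ε) := (Real.lt_sqrt (abs_nonneg _)).2 <| by
      rw [sq_abs]
      unfold sqDist at hlt
      linarith [sq_nonneg (p.2 - k)]
    rw [abs_lt] at habs
    constructor
    · have := Int.floor_le (p₀.1 - 1 - √(2 * ε))
      have h : ((⌊p₀.1 - 1 - √(2 * ε)⌋ : ℤ) : ℝ) ≤ k := by linarith
      exact_mod_cast h
    · have := Int.le_ceil (p₀.1 + 1 + √(2 * ε))
      have h : (k : ℝ) ≤ (⌈p₀.1 + 1 + √(2 * ε)⌉ : ℤ) := by linarith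
      exact_mod_cast h
  have := contMDiff_finsum (fun k => (hterm k).contMDiff) hlf
  exact contDiff_const.mul this.contDiff

theorem isDiagonalBump_latticeBump (hε : 0 < ε) : IsDiagonalBump (latticeBump ε) (2 * √ε) where
  smooth := contDiff_latticeBump hε
  nonneg := latticeBump_nonneg ε
  periodic := latticeBump_periodic ε
  eq_zero x X h := latticeBump_eq_zero hε fun k => by
    have h1 : (2 * √ε) ^ 2 ≤ (X - x) ^ 2 := by
      rw [← sq_abs (X - x)]
      gcongr
    rw [mul_pow, Real.sq_sqrt hε.le] at h1
    unfold sqDist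
    linarith [sq_nonneg (x - k + (X - k))]

/-- Near a lattice point only the summand of that point contributes. -/
theorem latticeBump_near (hε : 0 < ε) {d : ℝ} (hd1 : d ≤ √ε / 2) (hd2 : d ≤ 1 - √ε) {k : ℤ}
    {x X : ℝ} (hx : |x - k| ≤ d) (hX : |X - k| ≤ d) :
    latticeBump ε x X = sqDist k x X / 2 := by
  have hsq : √ε ^ 2 = ε := Real.sq_sqrt hε.le
  have hd0 : 0 ≤ d := (abs_nonneg _).trans hx
  have hle : ∀ z : ℝ, |z - k| ≤ d → (z - k) ^ 2 ≤ ε / 4 := fun z hz => by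
    rw [← sq_abs, ← hsq]
    calc |z - k| ^ 2 ≤ (√ε / 2) ^ 2 := by
          gcongr
          exact hz.trans hd1
      _ = √ε ^ 2 / 4 := by ring
  refine latticeBump_eq_half_sqDist hε k ?_ fun j hj => ?_
  · unfold sqDist
    linarith [hle x hx, hle X hX]
  · have hjk : (1 : ℝ) ≤ |(k : ℝ) - j| := by
      exact_mod_cast Int.one_le_abs (sub_ne_zero.2 hj.symm)
    have hge : ∀ z : ℝ, |z - k| ≤ d → ε ≤ (z - j) ^ 2 := fun z hz => by
      have h1 : |(k : ℝ) - j| ≤ |z - k| + |z - j| := by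
        rw [show (k : ℝ) - j = -(z - k) + (z - j) by ring]
        exact (abs_add_le _ _).trans (by rw [abs_neg])
      rw [← hsq, ← sq_abs (z - j)]
      gcongr
      linarith
    unfold sqDist
    linarith [hge x hx, hge X hX]

theorem partial_latticeBump_near (hε : 0 < ε) {d : ℝ} (hd1 : d ≤ √ε / 2) (hd2 : d ≤ 1 - √ε)
    {k : ℤ} {x X : ℝ} (hx : |x - k| < d) (hX : |X - k| < d) :
    partialX (latticeBump ε) x X = x - k ∧ partialSnd (latticeBump ε) x X = X - k := by
  have hcont : ∀ z : ℝ, ContinuousAt (fun s : ℝ => |s - k|) z := fun z => by fun_prop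
  have hder : ∀ z w : ℝ, HasDerivAt (fun s : ℝ => ((s - k) ^ 2 + w) / 2) (z - k) z := fun z w => by
    have := ((((hasDerivAt_id z).sub_const (k : ℝ)).pow 2).add_const w).div_const 2
    exact this.congr_deriv (by simp)
  constructor
  · refine ((hder x ((X - k) ^ 2)).congr_of_eventuallyEq ?_).deriv
    filter_upwards [(hcont x).eventually (gt_mem_nhds hx)] with s hs
    exact latticeBump_near hε hd1 hd2 hs.le hX.le
  · refine ((hder X ((x - k) ^ 2)).congr_of_eventuallyEq ?_).deriv
    filter_upwards [(hcont X).eventually (gt_mem_nhds hX)] with s hs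
    rw [latticeBump_near hε hd1 hd2 hx.le hs.le, sqDist, add_comm]

/-! ### The generating function of the theorem -/

theorem genFun_eq (ε θ x X : ℝ) : genFun ε θ x X =
    (x - X) ^ 2 / (2 * Real.sin θ) - Real.tan (θ / 2) * latticeBump ε x X := by
  have : ∑ᶠ k : ℤ, profile ε θ (sqDist k x X) * sqDist k x X =
      Real.tan (θ / 2) * ∑ᶠ k : ℤ, cutoff ε (sqDist k x X) * sqDist k x X := by
    rw [mul_finsum]
    simp only [profile, mul_assoc]
  rw [genFun, this, latticeBump]
  ring

theorem sin_mul_tan_half {θ : ℝ} (h : Real.cos (θ / 2) ≠ 0) :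
    Real.sin θ * Real.tan (θ / 2) = 1 - Real.cos θ := by
  have h1 : Real.sin θ = 2 * Real.sin (θ / 2) * Real.cos (θ / 2) := by
    rw [← Real.sin_two_mul]
    ring_nf
  have h2 : Real.cos θ = 1 - 2 * Real.sin (θ / 2) ^ 2 := by
    rw [Real.sin_sq_eq_half_sub, mul_div_cancel₀ _ two_ne_zero]
    ring
  rw [h1, h2, Real.tan_eq_sin_div_cos]
  field_simp
  ring

theorem isGeneratedBy_scaledMap (hε : 0 < ε) {θ : ℝ} (hs : Real.sin θ ≠ 0)
    (hc : Real.cos (θ / 2) ≠ 0) (hl : IsSmallCoeff (latticeBump ε) (1 - Real.cos θ)) :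
    IsGeneratedBy (genFun ε θ) (scaledMap (latticeBump ε) (Real.sin θ) (1 - Real.cos θ)) := by
  have hF := isDiagonalBump_latticeBump hε
  intro x y X Y
  have hst := sin_mul_tan_half hc
  have hX : deriv (fun s => genFun ε θ s X) x =
      (x - X) / Real.sin θ - Real.tan (θ / 2) * partialX (latticeBump ε) x X := by
    simp only [genFun_eq]
    have h := (((((hasDerivAt_id x).sub_const X).pow 2).div_const (2 * Real.sin θ))).sub
      ((hasDerivAt_fst hF.smooth x X).const_mul (Real.tan (θ / 2)))
    refine h.deriv.trans ?_
    simp only [id]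
    field_simp
    ring
  have hY : deriv (fun S => genFun ε θ x S) X =
      (X - x) / Real.sin θ - Real.tan (θ / 2) * partialSnd (latticeBump ε) x X := by
    simp only [genFun_eq]
    have h := (((((hasDerivAt_id X).const_sub x).pow 2).div_const (2 * Real.sin θ))).sub
      ((hasDerivAt_snd hF.smooth x X).const_mul (Real.tan (θ / 2)))
    refine h.deriv.trans ?_
    simp only [id]
    field_simp
    ring
  have e1 : deriv (fun s => genFun ε θ s X) x = -y ↔
      X = newPos (latticeBump ε) (1 - Real.cos θ) x (Real.sin θ * y) := by
    rw [← hF.newPos_eq_iff hl, hX, ← hst, sub_eq_iff_eq_add, div_eq_iff hs]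
    constructor <;> intro h <;> linarith
  rw [e1, hY, scaledMap, Prod.mk.injEq, eq_comm (b := X)]
  refine and_congr_right fun h => ?_
  rw [newMom, ← h, ← hst]
  congr! 1
  field_simp

theorem scaledMap_rotation (hε : 0 < ε) {θ : ℝ} (hs : Real.sin θ ≠ 0)
    (hl : IsSmallCoeff (latticeBump ε) (1 - Real.cos θ)) {δ : ℝ} (hδ : 0 ≤ δ) (hd1 : δ < √ε / 2)
    (hd2 : δ < 1 - √ε) (k : ℤ) {x y : ℝ} (h : (x - k) ^ 2 + y ^ 2 ≤ δ ^ 2) :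
    scaledMap (latticeBump ε) (Real.sin θ) (1 - Real.cos θ) (x, y) =
      (Real.cos θ * (x - k) + Real.sin θ * y + k,
        -Real.sin θ * (x - k) + Real.cos θ * y) := by
  have hF := isDiagonalBump_latticeBump hε
  have hcs := Real.sin_sq_add_cos_sq θ
  set X := Real.cos θ * (x - k) + Real.sin θ * y + k with hX
  have hx1 : |x - k| ≤ δ := abs_le_of_sq_le_sq (by linarith [sq_nonneg y]) hδ
  -- `(X - k, Y)` is the image of `(x - k, y)` under a rotation.
  have hX1 : |X - k| ≤ δ := by
    refine abs_le_of_sq_le_sq ?_ hδ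
    have e : (X - k) ^ 2 + (-Real.sin θ * (x - k) + Real.cos θ * y) ^ 2 =
        (Real.sin θ ^ 2 + Real.cos θ ^ 2) * ((x - k) ^ 2 + y ^ 2) := by
      rw [hX]
      ring
    rw [hcs, one_mul] at e
    linarith [sq_nonneg (-Real.sin θ * (x - k) + Real.cos θ * y)]
  obtain ⟨d, hd, hd'⟩ := exists_between (lt_min hd1 hd2)
  obtain ⟨hp1, hp2⟩ := partial_latticeBump_near hε (lt_min_iff.1 hd').1.le (lt_min_iff.1 hd').2.le (hx1.trans_lt hd)
    (hX1.trans_lt hd)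
  have hnew : newPos (latticeBump ε) (1 - Real.cos θ) x (Real.sin θ * y) = X :=
    ((hF.newPos_eq_iff hl).1 (by rw [hp1, hX]; ring)).symm
  rw [scaledMap, newMom]
  simp only [hnew, hp2]
  refine Prod.ext rfl ?_
  simp only
  rw [div_eq_iff hs, hX]
  linear_combination (x - k) * hcs

theorem scaledMap_shear {F : ℝ → ℝ → ℝ} {R l s : ℝ} (hF : IsDiagonalBump F R)
    (hl : IsSmallCoeff F l) (hs : s ≠ 0) {x y : ℝ} (h : F x (x + s * y) = 0) :
    scaledMap F s l (x, y) = (x + s * y, y) := by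
  rw [scaledMap]
  simp only [hF.newPos_of_eq_zero hl h, hF.newMom_of_eq_zero hl h, mul_div_cancel_left₀ _ hs]

end BraidTwist

theorem proposition2p1 (ε : ℝ) (hε : 0 < ε) :
    ∃ N : ℕ, 3 ≤ N ∧ ∃ δ : ℝ, 0 < δ ∧
      ∀ n : ℕ, N ≤ n → ∀ σ : ℝ, (σ = 1 ∨ σ = -1) → ∀ θ : ℝ, θ = σ * (Real.pi / (2 * n)) →
        ∃ ψ : ℝ × ℝ → ℝ × ℝ,
          BraidTwist.IsGeneratedBy (BraidTwist.genFun ε θ) ψ ∧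
          ContDiff ℝ ∞ ψ ∧
          -- rotation by the angle `θ` near each lattice point `(k, 0)`
          (ε < 1 → ∀ (k : ℤ) (x y : ℝ), (x - k) ^ 2 + y ^ 2 ≤ δ ^ 2 →
            ψ (x, y) = (Real.cos θ * (x - k) + Real.sin θ * y + k,
              -Real.sin θ * (x - k) + Real.cos θ * y)) ∧
          -- shear away from the lattice points, i.e. off the support of the cutoff
          (∀ x y : ℝ, (∀ k : ℤ, 2 * ε ≤ BraidTwist.sqDist k x (x + Real.sin θ * y)) →
            ψ (x, y) = (x + Real.sin θ * y, y)) ∧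
          -- every annulus whose boundary lines avoid the support of the cutoff
          ∀ a b : ℝ, a < b → 2 * Real.sqrt ε ≤ |Real.sin θ| * |a| →
            2 * Real.sqrt ε ≤ |Real.sin θ| * |b| →
            BraidTwist.IsMonotoneTwist σ a b ψ ∧
            ∃ H : ℝ → ℝ → ℝ → ℝ, BraidTwist.IsHamiltonianFor σ a b ψ H := by
  have hF := BraidTwist.isDiagonalBump_latticeBump hε
  obtain ⟨k₀, hk₀, hH⟩ := hF.exists_isHamiltonianFor
  obtain ⟨N₀, hN₀⟩ := exists_nat_ge (2 / k₀)
  obtain ⟨δ, hδ, hδε⟩ : ∃ δ : ℝ, 0 < δ ∧ (ε < 1 → δ < √ε / 2 ∧ δ < 1 - √ε) := by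
    by_cases h : ε < 1
    · have h1 : 0 < √ε / 2 := by positivity
      have h2 : 0 < 1 - √ε := sub_pos.2 ((Real.sqrt_lt' one_pos).2 (by simpa using h))
      obtain ⟨δ, hδ, hδ'⟩ := exists_between (lt_min h1 h2)
      exact ⟨δ, hδ, fun _ => lt_min_iff.1 hδ'⟩
    · exact ⟨1, one_pos, fun h' => absurd h' h⟩
  refine ⟨max 3 N₀, le_max_left _ _, δ, hδ, fun n hn σ hσ θ hθ => ?_⟩
  have hn3 : (3 : ℝ) ≤ n := by exact_mod_cast (le_max_left _ _).trans hn
  have hnN : 2 / k₀ ≤ n := hN₀.trans (by exact_mod_cast (le_max_right _ _).trans hn)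
  set α : ℝ := Real.pi / (2 * n) with hα
  have hα0 : 0 < α := by positivity
  have hαn : α ≤ 2 / n := by
    rw [hα, div_le_div_iff₀ (by positivity) (by positivity)]
    nlinarith [Real.pi_le_four]
  have hα1 : α < 1 := hαn.trans_lt (by rw [div_lt_one (by positivity)]; linarith)
  have hsin : 0 < σ * Real.sin θ := by
    have := Real.sin_pos_of_pos_of_lt_pi hα0 (by linarith [Real.pi_gt_three])
    rcases hσ with rfl | rfl <;> simpa [hθ] using this
  have hs0 : Real.sin θ ≠ 0 := right_ne_zero_of_mul hsin.ne'
  have hcos : Real.cos (θ / 2) ≠ 0 := by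
    have h1 : |θ| = α := by
      rcases hσ with rfl | rfl <;> simp [hθ, abs_of_pos hα0]
    refine (Real.cos_pos_of_mem_Ioo ⟨?_, ?_⟩).ne'
    · linarith [neg_abs_le θ, Real.pi_gt_three]
    · linarith [le_abs_self θ, Real.pi_gt_three]
  -- `1 - cos θ ≤ θ² / 2 ≤ 2 / n ≤ k₀`
  have hk : 1 - Real.cos θ ≤ k₀ := by
    have hsq : θ ^ 2 = α ^ 2 := by rcases hσ with rfl | rfl <;> simp [hθ]
    have h2 : 2 / (n : ℝ) ≤ k₀ := by
      rw [div_le_iff₀ hk₀] at hnN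
      rw [div_le_iff₀ (by positivity)]
      linarith
    nlinarith [Real.one_sub_sq_div_two_le_cos (x := θ)]
  obtain ⟨hl, hham⟩ := hH (1 - Real.cos θ) (by linarith [Real.cos_le_one θ]) hk
  refine ⟨BraidTwist.scaledMap (BraidTwist.latticeBump ε) (Real.sin θ) (1 - Real.cos θ),
    BraidTwist.isGeneratedBy_scaledMap hε hs0 hcos hl, hF.contDiff_scaledMap hl _,
    fun hε1 k x y h => BraidTwist.scaledMap_rotation hε hs0 hl hδ.le (hδε hε1).1 (hδε hε1).2 k h,
    fun x y h => BraidTwist.scaledMap_shear hF hl hs0 (BraidTwist.latticeBump_eq_zero hε h),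
    fun a b hab ha hb => ?_⟩
  rw [← abs_mul] at ha hb
  exact ⟨hF.isMonotoneTwist_scaledMap hl hsin hab ha hb, hham σ _ a b hsin hab ha hb⟩
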